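/- Let $M$ be a compact, oriented, smooth Riemannian manifold of dimension $n\ge 1$ with (possibly empty) boundary $\partial M$, which carries the boundary orientation. Let $\mu_{\mathrm{vol}}$ be its volume form, $*$ its Hodge star, $\Omega^k(M)$ the smooth $k$-forms on $M$, and $i:\partial M\to M$ the inclusion; write $\eta|_{\partial M}=i^*\eta$. Put $\mathfrak g=\Omega^{n-1}(M)$ and $\mathfrak g^*=\Omega^1(M)$, paired by $\langle\alpha|\omega\rangle_{\mathfrak g}=\int_M\alpha\wedge\omega$. For $\omega\in\mathfrak g$ let $\hat\omega$ be the vector field with $\iota_{\hat\omega}\mu_{\mathrm{vol}}=\omega$. Let $V=\Omega^k(M)$ and $V^*=\Omega^{n-k}(M)$, paired by $\langle\bar a|a\rangle_{V^*}=\int_M\bar a\wedge a$. For $a\in V^*$ let $$\tilde\varphi_a:\mathfrak g\to V^*,\qquad \tilde\varphi_a(\omega)=\mathcal L_{\hat\omega}a .$$ A formal dual of $\tilde\varphi_a$ is a map $\tilde\varphi_a^*:V\to\mathfrak g^*$ such that $\langle\tilde\varphi_a^*(\bar a)|\omega\rangle_{\mathfrak g}=\langle\bar a|\tilde\varphi_a(\omega)\rangle_{V^*}$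 for all $\bar a\in V$ and all $\omega\in\mathfrak g$ whose support lies in the interior of $M$. In each of the following two cases, for every $a\in V^*$ the map $\tilde\varphi_a$ does take values in $V^*$ and has exactly one formal dual $\tilde\varphi_a^*$, and for all $\omega\in\mathfrak g$ and $\bar a\in V$ $$\langle\tilde\varphi_a^*(\bar a)|\omega\rangle_{\mathfrak g}=\langle\bar a|\tilde\varphi_a(\omega)\rangle_{V^*}+\int_{\partial M}\eta_{\tilde\varphi_a}(\omega,\bar a)|_{\partial M},$$ where $\tilde\varphi_a^*(\bar a)\in\Omega^1(M)$ and the surface term $\eta_{\tilde\varphi_a}(\omega,\bar a)\in\Omega^{n-1}(M)$ are given as follows. 1. If $V=\Omega^0(M)$ and $V^*=\Omega^n(M)$, then $$\tilde\varphi_a^*(\bar a)=-(*a)\,d\bar a,\qquad \eta_{\tilde\varphi_a}(\omega,\bar a)=-(*a)\,\omega\wedge\bar a .$$ 2. If $V=\Omega^n(M)$ and $V^*=\Omega^0(M)$, then $$\tilde\varphi_a^*(\bar a)=(*\bar a)\,da,\qquad \eta_{\tilde\varphi_a}(\omega,\bar a)=0 .$$ -/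

import Mathlib

open Set Filter Topology MeasureTheory Module Bundle
open scoped Manifold ContDiff

noncomputable section

namespace FluidForms

/-! ### Multilinear algebra on a finite-dimensional real vector space -/

theorem update_id_apply {T : Type*} [AddCommGroup T] [Module ℝ T] {k : ℕ} (L : T →ₗ[ℝ] T) (w : Fin k → T) (j : Fin k) :
    (fun i => (Function.update (fun _ => LinearMap.id) j L : Fin k → T →ₗ[ℝ] T) i (w i)) =
      Function.update w j (L (w j)) := by
  funext i
  by_cases h : i = j
  · subst h
    simp
  · simp [h]

section Algebra

variable {T : Type*} [AddCommGroup T] [Module ℝ T] [TopologicalSpace T]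
  [IsTopologicalAddGroup T] [ContinuousSMul ℝ T] [T2Space T] [FiniteDimensional ℝ T]

theorem continuous_alternating {k : ℕ} (f : T [⋀^Fin k]→ₗ[ℝ] ℝ) : Continuous f := by
  let b := finBasis ℝ T
  have h : (f : (Fin k → T) → ℝ) = fun v => ∑ r : Fin k → Fin (finrank ℝ T),
      (∏ i, b.coord (r i) (v i)) * f (fun i => b (r i)) := by
    funext v
    have hv : v = fun i => ∑ j, b.coord j (v i) • b j := by
      funext i
      exact (b.sum_repr (v i)).symm
    conv_lhs => rw [hv]
    change f.toMultilinearMap _ = _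
    rw [MultilinearMap.map_sum]
    refine Finset.sum_congr rfl fun r _ => ?_
    rw [MultilinearMap.map_smul_univ]
    rfl
  rw [h]
  refine continuous_finsetSum _ fun r _ => Continuous.mul ?_ continuous_const
  refine continuous_finsetProd _ fun i _ => ?_
  exact (LinearMap.continuous_of_finiteDimensional (b.coord (r i))).comp (continuous_apply i)

/-- An alternating form on a finite-dimensional space, as a continuous alternating form. -/
def toCont {k : ℕ} (f : T [⋀^Fin k]→ₗ[ℝ] ℝ) : T [⋀^Fin k]→L[ℝ] ℝ :=
  { f with cont := continuous_alternating f }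

/-- The wedge product: the sum over all `(k, l)`-shuffles `σ` of
`sign σ * α (v_{σ 1}, …, v_{σ k}) * β (v_{σ (k+1)}, …, v_{σ (k+l)})`. -/
def wedgeAt {k l r : ℕ} (h : k + l = r) (α : T [⋀^Fin k]→L[ℝ] ℝ) (β : T [⋀^Fin l]→L[ℝ] ℝ) :
    T [⋀^Fin r]→L[ℝ] ℝ :=
  toCont (((LinearMap.mul' ℝ ℝ).compAlternatingMap
    (α.toAlternatingMap.domCoprod β.toAlternatingMap)).domDomCongr
      (finSumFinEquiv.trans (finCongr h)))

/-- The interior product `ι_v α = α (v, ·, …, ·)`. -/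
def interiorAt {k : ℕ} (v : T) (α : T [⋀^Fin (k + 1)]→L[ℝ] ℝ) : T [⋀^Fin k]→L[ℝ] ℝ :=
  toCont (α.toAlternatingMap.curryLeft v)

/-- `α (w 0, …, w (k - 1), ·, …, ·)`. -/
def contractFirst {l : ℕ} :
    (k : ℕ) → (T [⋀^Fin (l + k)]→L[ℝ] ℝ) → (Fin k → T) → T [⋀^Fin l]→L[ℝ] ℝ
  | 0, α, _ => α
  | k + 1, α, w => contractFirst k (interiorAt (w 0) α) (fun i => w i.succ)

/-- The action of an endomorphism `L` on `α` as a derivation: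
`(w 0, …, w (k - 1)) ↦ ∑ j, α (w 0, …, L (w j), …, w (k - 1))`. -/
def derivAct {k : ℕ} (L : T →ₗ[ℝ] T) (α : T [⋀^Fin k]→L[ℝ] ℝ) : T [⋀^Fin k]→L[ℝ] ℝ :=
  toCont
    { ∑ j : Fin k, α.toMultilinearMap.compLinearMap
        (Function.update (fun _ => LinearMap.id) j L) with
      map_eq_zero_of_eq' := by
        intro v i i' hv hi
        change (∑ j : Fin k, α.toMultilinearMap.compLinearMap
          (Function.update (fun _ => LinearMap.id) j L)) v = 0
        simp only [_root_.sum_apply, MultilinearMap.compLinearMap_apply,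
          update_id_apply]
        change ∑ j : Fin k, α (Function.update v j (L (v j))) = 0
        rw [← Finset.sum_subset (Finset.subset_univ {i, i'})]
        · rw [Finset.sum_pair hi]
          have hs : Function.update v i' (L (v i')) =
              Function.update v i (L (v i)) ∘ Equiv.swap i i' := by
            funext j
            by_cases h1 : j = i
            · subst h1
              simp [hi, Ne.symm hi, hv]
            · by_cases h2 : j = i'
              · subst h2
                simp [hv]
              · simp [Equiv.swap_apply_of_ne_of_ne h1 h2, h1, h2]
          rw [hs]
          have h := α.toAlternatingMap.map_swap (Function.update v i (L (v i))) hi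
          change _ + α.toAlternatingMap _ = 0
          rw [h]
          change α _ + -α _ = 0
          ring
        · intro j _ hj
          simp only [Finset.mem_insert, Finset.mem_singleton, not_or] at hj
          refine α.map_eq_zero_of_eq _ (i := i) (j := i') ?_ hi
          simp [Ne.symm hj.1, Ne.symm hj.2, hv] }

theorem derivAct_apply {k : ℕ} (L : T →ₗ[ℝ] T) (α : T [⋀^Fin k]→L[ℝ] ℝ) (w : Fin k → T) :
    derivAct L α w = ∑ j, α (Function.update w j (L (w j))) := by
  change (∑ j : Fin k, α.toMultilinearMap.compLinearMap
    (Function.update (fun _ => LinearMap.id) j L)) w = _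
  simp only [_root_.sum_apply, MultilinearMap.compLinearMap_apply, update_id_apply]
  rfl

end Algebra

/-! ### Differential forms on a manifold with boundary of dimension `m + 1` -/

section Forms

variable {m : ℕ} {M : Type*} [TopologicalSpace M] [ChartedSpace (EuclideanHalfSpace (m + 1)) M]

/-- A (not necessarily smooth) differential `k`-form on the `(m + 1)`-dimensional manifold `M`. -/
abbrev DForm (m : ℕ) (M : Type*) [TopologicalSpace M]
    [ChartedSpace (EuclideanHalfSpace (m + 1)) M] (k : ℕ) :=
  (x : M) → TangentSpace (𝓡∂ (m + 1)) x [⋀^Fin k]→L[ℝ] ℝ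

abbrev VField (m : ℕ) (M : Type*) [TopologicalSpace M]
    [ChartedSpace (EuclideanHalfSpace (m + 1)) M] :=
  (x : M) → TangentSpace (𝓡∂ (m + 1)) x

instance (x : M) : FiniteDimensional ℝ (TangentSpace (𝓡∂ (m + 1)) x) :=
  inferInstanceAs (FiniteDimensional ℝ (EuclideanSpace ℝ (Fin (m + 1))))

instance (x : M) : Fact (finrank ℝ (TangentSpace (𝓡∂ (m + 1)) x) = m + 1) :=
  ⟨finrank_euclideanSpace_fin (𝕜 := ℝ) (n := m + 1)⟩

instance (x : M) : T2Space (TangentSpace (𝓡∂ (m + 1)) x) :=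
  inferInstanceAs (T2Space (EuclideanSpace ℝ (Fin (m + 1))))

/-- The derivative at `y` of the inverse of the chart at `i`. -/
def dChartSymm (i : M) (y : EuclideanSpace ℝ (Fin (m + 1))) :
    EuclideanSpace ℝ (Fin (m + 1)) →L[ℝ]
      TangentSpace (𝓡∂ (m + 1)) ((extChartAt (𝓡∂ (m + 1)) i).symm y) :=
  mfderivWithin 𝓘(ℝ, EuclideanSpace ℝ (Fin (m + 1))) (𝓡∂ (m + 1))
    (extChartAt (𝓡∂ (m + 1)) i).symm (range (𝓡∂ (m + 1))) y

/-- The derivative at `x` of the chart at `i`. -/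
def dChart (i x : M) :
    TangentSpace (𝓡∂ (m + 1)) x →L[ℝ] EuclideanSpace ℝ (Fin (m + 1)) :=
  mfderiv (𝓡∂ (m + 1)) 𝓘(ℝ, EuclideanSpace ℝ (Fin (m + 1))) (extChartAt (𝓡∂ (m + 1)) i) x

/-- The coordinate expression of a form in the chart at `i`: its pullback under the inverse
chart, meaningful on the target of the chart. -/
def inChart {k : ℕ} (β : DForm m M k) (i : M) (y : EuclideanSpace ℝ (Fin (m + 1))) :
    EuclideanSpace ℝ (Fin (m + 1)) [⋀^Fin k]→L[ℝ] ℝ :=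
  (β ((extChartAt (𝓡∂ (m + 1)) i).symm y)).compContinuousLinearMap (dChartSymm i y)

/-- The coordinate expression of a vector field in the chart at `i`. -/
def vInChart (v : VField m M) (i : M) (y : EuclideanSpace ℝ (Fin (m + 1))) :
    EuclideanSpace ℝ (Fin (m + 1)) :=
  dChart i ((extChartAt (𝓡∂ (m + 1)) i).symm y) (v ((extChartAt (𝓡∂ (m + 1)) i).symm y))

/-- Smooth forms: `Ω^k(M)`. -/
def IsSmooth {k : ℕ} (β : DForm m M k) : Prop :=
  ∀ i : M, ContDiffOn ℝ ∞ (inChart β i) (extChartAt (𝓡∂ (m + 1)) i).target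

def wedge {k l r : ℕ} (h : k + l = r) (α : DForm m M k) (β : DForm m M l) : DForm m M r :=
  fun x => wedgeAt h (α x) (β x)

/-- The product of a function (a `0`-form) and a form. -/
def fsmul {k : ℕ} (f : DForm m M 0) (β : DForm m M k) : DForm m M k :=
  fun x => f x Fin.elim0 • β x

/-- The exterior derivative, computed at `x` in the chart at `x`. -/
def extD {k : ℕ} (β : DForm m M k) : DForm m M (k + 1) := fun x =>
  (extDerivWithin (inChart β x) (range (𝓡∂ (m + 1)))
    (extChartAt (𝓡∂ (m + 1)) x x)).compContinuousLinearMap (dChart x x)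

/-- The Lie derivative of a form `β` along a vector field `v`, computed at `x` in the chart at
`x`. In coordinates it is `w ↦ (D β · v) (w) + ∑ j, β (w 0, …, D v · w j, …, w (k - 1))`. -/
def lieD {k : ℕ} (v : VField m M) (β : DForm m M k) : DForm m M k := fun x =>
  (fderivWithin ℝ (inChart β x) (range (𝓡∂ (m + 1))) (extChartAt (𝓡∂ (m + 1)) x x)
      (vInChart v x (extChartAt (𝓡∂ (m + 1)) x x)) +
    derivAct (fderivWithin ℝ (vInChart v x) (range (𝓡∂ (m + 1)))
        (extChartAt (𝓡∂ (m + 1)) x x)).toLinearMap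
      (inChart β x (extChartAt (𝓡∂ (m + 1)) x x))).compContinuousLinearMap (dChart x x)

/-! ### Orientation, volume form, Hodge star -/

variable [RiemannianBundle (fun x : M => TangentSpace (𝓡∂ (m + 1)) x)]

/-- The Riemannian volume form of a pointwise choice of orientations: it takes the value `1` on
positively oriented orthonormal bases. -/
def volOf (o : (x : M) → Orientation ℝ (TangentSpace (𝓡∂ (m + 1)) x) (Fin (m + 1))) :
    DForm m M (m + 1) :=
  fun x => toCont ((o x).volumeForm)

/-- `1` or `-1` according to whether the coordinate frame of the chart at `i` is positively or
negatively oriented at the point with coordinates `y`. -/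
def chartSign (o : (x : M) → Orientation ℝ (TangentSpace (𝓡∂ (m + 1)) x) (Fin (m + 1)))
    (i : M) (y : EuclideanSpace ℝ (Fin (m + 1))) : ℝ :=
  (SignType.sign (inChart (volOf o) i y (fun j => EuclideanSpace.single j 1)) : ℝ)

end Forms

/-- An orientation of `M`: a choice of orientations of the tangent spaces for which the
orientation of the coordinate frame of each chart is locally constant. -/
structure ManifoldOrientation (m : ℕ) (M : Type*) [TopologicalSpace M]
    [ChartedSpace (EuclideanHalfSpace (m + 1)) M]
    [RiemannianBundle (fun x : M => TangentSpace (𝓡∂ (m + 1)) x)] where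
  orient : (x : M) → Orientation ℝ (TangentSpace (𝓡∂ (m + 1)) x) (Fin (m + 1))
  continuousOn_sign : ∀ i : M,
    ContinuousOn (chartSign orient i) (extChartAt (𝓡∂ (m + 1)) i).target

section Riemannian

variable {m : ℕ} {M : Type*} [TopologicalSpace M] [ChartedSpace (EuclideanHalfSpace (m + 1)) M]
  [RiemannianBundle (fun x : M => TangentSpace (𝓡∂ (m + 1)) x)]

/-- The Riemannian volume form. -/
def vol (o : ManifoldOrientation m M) : DForm m M (m + 1) := volOf o.orient

/-- The Hodge star on `k`-forms: with an orthonormal basis `e`,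
`(⋆ α) (v) = ∑_{f 0 < ⋯ < f (k - 1)} α (e_{f 0}, …) * vol (e_{f 0}, …, e_{f (k - 1)}, v)`,
where the sum over increasing `f` is written as `1 / k!` times the sum over all `f`.
Equivalently, `β ∧ ⋆ α = ⟨β, α⟩ vol` for all `k`-forms `β`. -/
def star {k l : ℕ} (h : l + k = m + 1) (o : ManifoldOrientation m M) (α : DForm m M k) :
    DForm m M l := fun x =>
  ((k.factorial : ℝ)⁻¹) • ∑ f : Fin k → Fin (finrank ℝ (TangentSpace (𝓡∂ (m + 1)) x)),
    α x (fun i => stdOrthonormalBasis ℝ (TangentSpace (𝓡∂ (m + 1)) x) (f i)) •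
      contractFirst k
        (toCont ((vol o x).toAlternatingMap.domDomCongr (finCongr h.symm)))
        (fun i => stdOrthonormalBasis ℝ (TangentSpace (𝓡∂ (m + 1)) x) (f i))

/-- The vector field `ω̂` of an `m`-form `ω`: the unique one with `ι_ω̂ vol = ω`. -/
def hat (o : ManifoldOrientation m M) (w : DForm m M m) : VField m M := fun x =>
  Function.invFun
    (fun v : TangentSpace (𝓡∂ (m + 1)) x => interiorAt v (vol o x)) (w x)

/-- The interconnection map `φ̃_a : ω ↦ L_ω̂ a`. -/
def interconnection {l : ℕ} (o : ManifoldOrientation m M) (a : DForm m M l) (w : DForm m M m) :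
    DForm m M l :=
  lieD (hat o w) a

/-! ### Integration over `M` and over its boundary -/

/-- The inclusion `y ↦ (0, y)` of the boundary hyperplane of the half-space. -/
def bdryIncl (m : ℕ) : EuclideanSpace ℝ (Fin m) →L[ℝ] EuclideanSpace ℝ (Fin (m + 1)) :=
  LinearMap.toContinuousLinearMap
    { toFun := fun y => WithLp.toLp 2 (Fin.cons 0 (fun j => y j))
      map_add' := by
        intro y z
        ext j
        refine Fin.cases ?_ (fun j => ?_) j <;> simp
      map_smul' := by
        intro c y
        ext j
        refine Fin.cases ?_ (fun j => ?_) j <;> simp }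

/-- Orientation of the boundary in the boundary chart induced by the chart at `i`, outward normal
first: the sign of the frame `(-∂_0, ∂_1, …, ∂_m)`, `-∂_0` being outward pointing. -/
def bdrySign (o : ManifoldOrientation m M) (i : M) (y : EuclideanSpace ℝ (Fin m)) : ℝ :=
  (SignType.sign (inChart (vol o) i (bdryIncl m y)
    (Fin.cons (-EuclideanSpace.single 0 1)
      (fun j => bdryIncl m (EuclideanSpace.single j 1)))) : ℝ)

/-- The trace of a form on the boundary (its pullback under the inclusion of the boundary), in the
boundary chart `y ↦ (chart at i)⁻¹ (0, y)`. -/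
def traceInChart {k : ℕ} (η : DForm m M k) (i : M) (y : EuclideanSpace ℝ (Fin m)) :
    EuclideanSpace ℝ (Fin m) [⋀^Fin k]→L[ℝ] ℝ :=
  (inChart η i (bdryIncl m y)).compContinuousLinearMap (bdryIncl m)

variable [IsManifold (𝓡∂ (m + 1)) ∞ M] [CompactSpace M] [T2Space M]

/-- A smooth partition of unity subordinate to the cover of `M` by the domains of its charts. -/
def chartPOU (m : ℕ) (M : Type*) [TopologicalSpace M]
    [ChartedSpace (EuclideanHalfSpace (m + 1)) M]
    [IsManifold (𝓡∂ (m + 1)) ∞ M] [CompactSpace M] [T2Space M] :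
    SmoothPartitionOfUnity M (𝓡∂ (m + 1)) M univ :=
  Classical.choose (SmoothPartitionOfUnity.exists_isSubordinate_chartAt_source (𝓡∂ (m + 1)) M)

/-- The integral of a top form over the oriented manifold `M`. -/
def integralM (o : ManifoldOrientation m M) (β : DForm m M (m + 1)) : ℝ :=
  ∑ᶠ i : M, ∫ y in (extChartAt (𝓡∂ (m + 1)) i).target,
    chartSign o.orient i y * chartPOU m M i ((extChartAt (𝓡∂ (m + 1)) i).symm y) *
      inChart β i y (fun j => EuclideanSpace.single j 1)

/-- The integral of the trace of an `m`-form over the boundary of `M`, which carries the boundary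
orientation. -/
def integralBdry (o : ManifoldOrientation m M) (η : DForm m M m) : ℝ :=
  ∑ᶠ i : M, ∫ y in {y | bdryIncl m y ∈ (extChartAt (𝓡∂ (m + 1)) i).target},
    bdrySign o i y * chartPOU m M i ((extChartAt (𝓡∂ (m + 1)) i).symm (bdryIncl m y)) *
      traceInChart η i y (fun j => EuclideanSpace.single j 1)

/-- The duality pairing `⟨α | β⟩ = ∫_M α ∧ β` of forms of complementary degrees. -/
def pairing {k l : ℕ} (h : k + l = m + 1) (o : ManifoldOrientation m M)
    (α : DForm m M k) (β : DForm m M l) : ℝ :=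
  integralM o (wedge h α β)

/-- `ψ : Ω^k(M) → Ω^1(M)` is a formal dual of `φ : Ω^m(M) → Ω^l(M)`, `k + l = dim M`:
`⟨ψ ā | ω⟩ = ⟨ā | φ ω⟩` for all `ω` supported in the interior of `M`. -/
def IsFormalDual {k l : ℕ} (h : k + l = m + 1) (o : ManifoldOrientation m M)
    (φ : DForm m M m → DForm m M l) (ψ : DForm m M k → DForm m M 1) : Prop :=
  ∀ abar : DForm m M k, IsSmooth abar → IsSmooth (ψ abar) ∧
    ∀ w : DForm m M m, IsSmooth w →
      closure {x : M | w x ≠ 0} ⊆ (𝓡∂ (m + 1)).interior M →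
      pairing (Nat.add_comm 1 m) o (ψ abar) w = pairing h o abar (φ w)

/-- `η` is a surface term for `φ` and `ψ`: for all `ω`, `ā`, the form `η ω ā` is in `Ω^m(M)` and
`⟨ψ ā | ω⟩ = ⟨ā | φ ω⟩ + ∫_∂M η ω ā`. -/
def HasSurfaceTerm {k l : ℕ} (h : k + l = m + 1) (o : ManifoldOrientation m M)
    (φ : DForm m M m → DForm m M l) (ψ : DForm m M k → DForm m M 1)
    (η : DForm m M m → DForm m M k → DForm m M m) : Prop :=
  ∀ (w : DForm m M m) (abar : DForm m M k), IsSmooth w → IsSmooth abar →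
    IsSmooth (η w abar) ∧
    pairing (Nat.add_comm 1 m) o (ψ abar) w =
      pairing h o abar (φ w) + integralBdry o (η w abar)

end Riemannian

end FluidForms

end

/-!
Write `v = ω̂` and `g = ⋆ a`. For a `1`-form `α` one has `α ∧ ω = α (v) vol`, so `-g df ∧ ω` is
`-(L_v f) a = f L_v a - L_v (f a)`. For a top form `β` one has `L_v β = d (ι_v β)`, hence
`∫_M L_v β = ∫_∂M ι_v β`, and `ι_v (f a) = f g ω`; this gives the surface term. If `a` is a
function and `b = ⋆ b vol` a top form, then `⋆ b da ∧ ω = (L_v a) b` holds pointwise.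

Integration over `M`: the integral of a form supported in one chart does not depend on the chart,
so Stokes' theorem follows from the divergence theorem on the half-space after multiplying `β` by
the functions of the partition of unity. In a chart the square of the coefficient of `vol` is the
Gram determinant of the coordinate frame and its sign is locally constant, so `vol` is smooth.

Uniqueness: let `γ` be the difference of two candidates for the dual at `ā`, `e` a coordinate field
near an interior point and `χ` a bump function there. Testing with `ω = ι_v vol`,
`v = χ γ(e) e`, gives `∫_M χ γ(e) ^ 2 vol = 0`. So `γ` vanishes on the interior, which is dense.
-/

noncomputable section

namespace FluidForms

section Algebra

variable {T : Type*} [AddCommGroup T] [Module ℝ T] [TopologicalSpace T]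

theorem topForm_ext {n : ℕ} (b : Basis (Fin n) ℝ T) {α β : T [⋀^Fin n]→L[ℝ] ℝ}
    (h : α b = β b) : α = β := by
  refine ContinuousAlternatingMap.toAlternatingMap_injective ?_
  rw [α.toAlternatingMap.eq_smul_basis_det b, β.toAlternatingMap.eq_smul_basis_det b]
  exact congrArg (· • b.det) h

theorem sign_mul_apply_comp_perm {k : ℕ} (α : T [⋀^Fin k]→L[ℝ] ℝ) (v : Fin k → T)
    (σ : Equiv.Perm (Fin k)) : ((Equiv.Perm.sign σ : ℤ) : ℝ) * α (v ∘ σ) = α v := by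
  have h : α (v ∘ σ) = ((Equiv.Perm.sign σ : ℤ) : ℝ) * α v :=
    (α.toAlternatingMap.map_perm v σ).trans (by rw [Units.smul_def, zsmul_eq_mul]; rfl)
  rw [h, ← mul_assoc, ← Int.cast_mul, ← Units.val_mul, Int.units_mul_self, Units.val_one,
    Int.cast_one, one_mul]

theorem sign_mul_apply_cons_comp_perm_succ {m : ℕ} (μ : T [⋀^Fin (m + 1)]→L[ℝ] ℝ)
    (b : Fin (m + 1) → T) (j : Fin (m + 1)) (σ : Equiv.Perm (Fin (m + 1))) :
    ((Equiv.Perm.sign σ : ℤ) : ℝ) * μ (Fin.cons (b j) fun i => b (σ i.succ)) =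
      if σ 0 = j then μ b else 0 := by
  split_ifs with hσ
  · have hcons : (Fin.cons (b j) fun i => b (σ i.succ) : Fin (m + 1) → T) = b ∘ σ := by
      rw [← hσ]
      exact Fin.cons_self_tail (b ∘ σ)
    rw [hcons, sign_mul_apply_comp_perm]
  · obtain ⟨i, hi⟩ := Fin.exists_succ_eq.2 fun h0 : σ.symm j = 0 =>
      hσ (by rw [← h0, Equiv.apply_symm_apply])
    rw [μ.map_eq_zero_of_eq _ (i := 0) (j := i.succ) _ (Fin.succ_ne_zero i).symm, mul_zero]
    rw [Fin.cons_zero, Fin.cons_succ, hi, Equiv.apply_symm_apply]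

theorem sum_perm_ite_apply_zero_eq {m : ℕ} (j : Fin (m + 1)) (c : ℝ) :
    ∑ σ : Equiv.Perm (Fin (m + 1)), (if σ 0 = j then c else 0) = m.factorial * c := by
  rw [← Equiv.sum_comp (Equiv.Perm.decomposeFin (n := m)).symm, Fintype.sum_prod_type]
  simp [Fintype.card_perm]

variable [IsTopologicalAddGroup T] [ContinuousSMul ℝ T] [T2Space T] [FiniteDimensional ℝ T]

@[simp]
theorem toCont_apply {k : ℕ} (f : T [⋀^Fin k]→ₗ[ℝ] ℝ) (v : Fin k → T) : toCont f v = f v := rfl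

theorem interiorAt_apply {k : ℕ} (v : T) (α : T [⋀^Fin (k + 1)]→L[ℝ] ℝ) (w : Fin k → T) :
    interiorAt v α w = α (Fin.cons v w) := rfl

/- Summing over all permutations counts each shuffle `k! * l!` times; unlike the sum over shuffles,
this form can be evaluated term by term. -/
theorem factorial_mul_wedgeAt_apply {k l r : ℕ} (h : k + l = r) (α : T [⋀^Fin k]→L[ℝ] ℝ)
    (β : T [⋀^Fin l]→L[ℝ] ℝ) (v : Fin r → T) :
    ((k.factorial * l.factorial : ℕ) : ℝ) * wedgeAt h α β v =
      ∑ σ : Equiv.Perm (Fin r), ((Equiv.Perm.sign σ : ℤ) : ℝ) *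
        (α (fun i => v (σ (Fin.cast h (Fin.castAdd l i)))) *
          β (fun i => v (σ (Fin.cast h (Fin.natAdd k i))))) := by
  let e : Fin k ⊕ Fin l ≃ Fin r := finSumFinEquiv.trans (finCongr h)
  have hsum := congrArg (fun f => LinearMap.mul' ℝ ℝ (f (v ∘ e)))
    (MultilinearMap.domCoprod_alternization_eq α.toAlternatingMap β.toAlternatingMap)
  simp only [Fintype.card_fin, MultilinearMap.alternatization_apply, map_sum,
    AlternatingMap.smul_apply] at hsum
  rw [map_nsmul, nsmul_eq_mul] at hsum
  refine hsum.symm.trans (Fintype.sum_equiv e.permCongr _ _ fun σ => ?_)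
  rw [Units.smul_def, map_zsmul, zsmul_eq_mul, Equiv.Perm.sign_permCongr]
  have hl (i : Fin k) : e.symm (Fin.cast h (Fin.castAdd l i)) = Sum.inl i := by
    rw [Equiv.symm_apply_eq]
    rfl
  have hr (i : Fin l) : e.symm (Fin.cast h (Fin.natAdd k i)) = Sum.inr i := by
    rw [Equiv.symm_apply_eq]
    rfl
  simp only [Equiv.permCongr_apply, hl, hr]
  rfl

theorem wedgeAt_eq_of_factorial_mul {k l r : ℕ} {h : k + l = r} {α : T [⋀^Fin k]→L[ℝ] ℝ}
    {β : T [⋀^Fin l]→L[ℝ] ℝ} {v : Fin r → T} {c : ℝ}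
    (hc : ((k.factorial * l.factorial : ℕ) : ℝ) * wedgeAt h α β v =
      ((k.factorial * l.factorial : ℕ) : ℝ) * c) : wedgeAt h α β v = c :=
  mul_left_cancel₀ (by positivity) hc

theorem wedgeAt_zero_left {l : ℕ} (h : 0 + l = l) (f : T [⋀^Fin 0]→L[ℝ] ℝ)
    (β : T [⋀^Fin l]→L[ℝ] ℝ) : wedgeAt h f β = f Fin.elim0 • β := by
  ext v
  apply wedgeAt_eq_of_factorial_mul
  have hterm (σ : Equiv.Perm (Fin l)) : ((Equiv.Perm.sign σ : ℤ) : ℝ) *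
      (f (fun i => v (σ (Fin.cast h (Fin.castAdd l i)))) *
        β (fun i => v (σ (Fin.cast h (Fin.natAdd 0 i))))) = f Fin.elim0 * β v := by
    have hi (i : Fin l) : Fin.cast h (Fin.natAdd 0 i) = i := by ext; simp
    simp only [hi, Subsingleton.elim (fun i => v (σ (Fin.cast h (Fin.castAdd l i)))) Fin.elim0]
    rw [mul_left_comm, ← sign_mul_apply_comp_perm β v σ]
    rfl
  rw [factorial_mul_wedgeAt_apply, Finset.sum_congr rfl fun σ _ => hterm σ]
  simp [Fintype.card_perm]

theorem wedgeAt_zero_right {k : ℕ} (h : k + 0 = k) (α : T [⋀^Fin k]→L[ℝ] ℝ)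
    (f : T [⋀^Fin 0]→L[ℝ] ℝ) : wedgeAt h α f = f Fin.elim0 • α := by
  ext v
  apply wedgeAt_eq_of_factorial_mul
  have hterm (σ : Equiv.Perm (Fin k)) : ((Equiv.Perm.sign σ : ℤ) : ℝ) *
      (α (fun i => v (σ (Fin.cast h (Fin.castAdd 0 i)))) *
        f (fun i => v (σ (Fin.cast h (Fin.natAdd k i))))) = f Fin.elim0 * α v := by
    simp only [Subsingleton.elim (fun i => v (σ (Fin.cast h (Fin.natAdd k i)))) Fin.elim0]
    rw [← mul_assoc, mul_comm, ← sign_mul_apply_comp_perm α v σ]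
    rfl
  rw [factorial_mul_wedgeAt_apply, Finset.sum_congr rfl fun σ _ => hterm σ]
  simp [Fintype.card_perm]

theorem wedgeAt_add_right {k l r : ℕ} (h : k + l = r) (α : T [⋀^Fin k]→L[ℝ] ℝ)
    (β γ : T [⋀^Fin l]→L[ℝ] ℝ) : wedgeAt h α (β + γ) = wedgeAt h α β + wedgeAt h α γ := by
  ext v
  apply wedgeAt_eq_of_factorial_mul
  simp only [ContinuousAlternatingMap.add_apply, mul_add, factorial_mul_wedgeAt_apply,
    Finset.sum_add_distrib]

theorem wedgeAt_add_left {k l r : ℕ} (h : k + l = r) (α α' : T [⋀^Fin k]→L[ℝ] ℝ)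
    (β : T [⋀^Fin l]→L[ℝ] ℝ) : wedgeAt h (α + α') β = wedgeAt h α β + wedgeAt h α' β := by
  ext v
  apply wedgeAt_eq_of_factorial_mul
  simp only [ContinuousAlternatingMap.add_apply, add_mul, mul_add, factorial_mul_wedgeAt_apply,
    Finset.sum_add_distrib]

theorem wedgeAt_smul_right {k l r : ℕ} (h : k + l = r) (α : T [⋀^Fin k]→L[ℝ] ℝ) (c : ℝ)
    (β : T [⋀^Fin l]→L[ℝ] ℝ) : wedgeAt h α (c • β) = c • wedgeAt h α β := by
  ext v
  apply wedgeAt_eq_of_factorial_mul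
  simp only [ContinuousAlternatingMap.smul_apply, smul_eq_mul, mul_left_comm _ c,
    factorial_mul_wedgeAt_apply, Finset.mul_sum]

theorem interiorAt_add {k : ℕ} (v w : T) (α : T [⋀^Fin (k + 1)]→L[ℝ] ℝ) :
    interiorAt (v + w) α = interiorAt v α + interiorAt w α := by
  ext u
  exact congrArg (fun f => f u) (α.toAlternatingMap.curryLeft.map_add v w)

theorem interiorAt_smul {k : ℕ} (c : ℝ) (v : T) (α : T [⋀^Fin (k + 1)]→L[ℝ] ℝ) :
    interiorAt (c • v) α = c • interiorAt v α := by
  ext u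
  exact congrArg (fun f => f u) (α.toAlternatingMap.curryLeft.map_smul c v)

theorem wedgeAt_interiorAt_basis {m : ℕ} (h : 1 + m = m + 1) (b : Fin (m + 1) → T)
    (α : T [⋀^Fin 1]→L[ℝ] ℝ) (μ : T [⋀^Fin (m + 1)]→L[ℝ] ℝ) (j : Fin (m + 1)) :
    wedgeAt h α (interiorAt (b j) μ) b = α (fun _ => b j) * μ b := by
  apply wedgeAt_eq_of_factorial_mul
  have hterm (σ : Equiv.Perm (Fin (m + 1))) : ((Equiv.Perm.sign σ : ℤ) : ℝ) *
      (α (fun i => b (σ (Fin.cast h (Fin.castAdd m i)))) *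
        interiorAt (b j) μ (fun i => b (σ (Fin.cast h (Fin.natAdd 1 i))))) =
      if σ 0 = j then α (fun _ => b j) * μ b else 0 := by
    have h0 (i : Fin 1) : Fin.cast h (Fin.castAdd m i) = 0 := by ext; simp
    have hs (i : Fin m) : Fin.cast h (Fin.natAdd 1 i) = i.succ := by ext; simp
    simp only [h0, hs, interiorAt_apply]
    rw [mul_left_comm, sign_mul_apply_cons_comp_perm_succ, mul_ite, mul_zero]
    exact ite_congr rfl (fun hσ => by rw [hσ]) fun _ => rfl
  rw [factorial_mul_wedgeAt_apply, Finset.sum_congr rfl fun σ _ => hterm σ,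
    sum_perm_ite_apply_zero_eq, Nat.factorial_one, one_mul]

theorem wedgeAt_interiorAt {m : ℕ} (h : 1 + m = m + 1) (hT : finrank ℝ T = m + 1)
    (α : T [⋀^Fin 1]→L[ℝ] ℝ) (μ : T [⋀^Fin (m + 1)]→L[ℝ] ℝ) (v : T) :
    wedgeAt h α (interiorAt v μ) = α (fun _ => v) • μ := by
  let b : Basis (Fin (m + 1)) ℝ T := finBasisOfFinrankEq ℝ T hT
  let wedgeInterior : T →ₗ[ℝ] ℝ :=
    { toFun := fun v => wedgeAt h α (interiorAt v μ) b
      map_add' := fun v w => by rw [interiorAt_add, wedgeAt_add_right]; rfl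
      map_smul' := fun c v => by rw [interiorAt_smul, wedgeAt_smul_right]; rfl }
  let covector : T →ₗ[ℝ] ℝ :=
    (ContinuousAlternatingMap.ofSubsingleton ℝ T ℝ (0 : Fin 1)).symm α
  have heq : wedgeInterior = μ b • covector := b.ext fun j =>
    (wedgeAt_interiorAt_basis h b α μ j).trans (mul_comm _ _)
  exact topForm_ext b ((LinearMap.congr_fun heq v).trans (mul_comm _ _))

theorem interiorAt_injective {m : ℕ} (hT : finrank ℝ T = m + 1)
    {μ : T [⋀^Fin (m + 1)]→L[ℝ] ℝ} (hμ : μ ≠ 0) :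
    Function.Injective (fun v : T => interiorAt v μ) := by
  intro v v' (hv : interiorAt v μ = interiorAt v' μ)
  let b : Basis (Fin (m + 1)) ℝ T := finBasisOfFinrankEq ℝ T hT
  refine b.ext_elem fun j => smul_left_injective ℝ hμ ?_
  let α : T [⋀^Fin 1]→L[ℝ] ℝ := ContinuousAlternatingMap.ofSubsingleton ℝ T ℝ (0 : Fin 1)
    (LinearMap.toContinuousLinearMap (b.coord j))
  have hα (u : T) : wedgeAt (Nat.add_comm 1 m) α (interiorAt u μ) = b.repr u j • μ :=
    wedgeAt_interiorAt _ hT α μ u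
  exact (hα v).symm.trans (hv ▸ hα v')

theorem interiorAt_surjective {m : ℕ} (hT : finrank ℝ T = m + 1)
    {μ : T [⋀^Fin (m + 1)]→L[ℝ] ℝ} (hμ : μ ≠ 0) :
    Function.Surjective (fun v : T => interiorAt v μ) := by
  let e := exteriorPower.alternatingMapLinearEquiv (R := ℝ) (M := T) (N := ℝ) (n := m)
  have : FiniteDimensional ℝ (T [⋀^Fin m]→ₗ[ℝ] ℝ) := e.symm.finiteDimensional
  have hfinrank : finrank ℝ T = finrank ℝ (T [⋀^Fin m]→ₗ[ℝ] ℝ) := by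
    rw [e.finrank_eq, Subspace.dual_finrank_eq, exteriorPower.finrank_eq, hT,
      Nat.choose_succ_self_right]
  have hinj : Function.Injective μ.toAlternatingMap.curryLeft := fun v v' hv =>
    interiorAt_injective hT hμ (congrArg toCont hv)
  intro w
  obtain ⟨v, hv⟩ := (LinearMap.injective_iff_surjective_of_finrank_eq_finrank hfinrank).1 hinj
    w.toAlternatingMap
  exact ⟨v, ContinuousAlternatingMap.toAlternatingMap_injective hv⟩

theorem contractFirst_zero_apply (k : ℕ) (α : T [⋀^Fin (0 + k)]→L[ℝ] ℝ) (w : Fin k → T) :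
    contractFirst k α w Fin.elim0 = α (fun i => w (Fin.cast (Nat.zero_add k) i)) := by
  induction k with
  | zero => exact congrArg α (funext fun i => i.elim0)
  | succ k ih =>
    refine (ih (interiorAt (w 0) α) fun i => w i.succ).trans (congrArg α (funext fun i => ?_))
    refine Fin.cases ?_ (fun i => ?_) i <;> rfl

end Algebra

section InnerProduct

variable {T : Type*} [NormedAddCommGroup T] [InnerProductSpace ℝ T]

theorem volumeForm_sq {n : ℕ} [Fact (finrank ℝ T = n)] (o : Orientation ℝ T (Fin n))
    (b : OrthonormalBasis (Fin n) ℝ T) (v : Fin n → T) :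
    o.volumeForm v ^ 2 = (Matrix.gram ℝ v).det := by
  have hgram : Matrix.gram ℝ v = (b.toBasis.toMatrix v).transpose * b.toBasis.toMatrix v := by
    ext i j
    rw [Matrix.gram_apply, Matrix.mul_apply, ← b.sum_inner_mul_inner]
    simp [Basis.toMatrix_apply, b.repr_apply_apply, real_inner_comm]
  rw [hgram, Matrix.det_mul, Matrix.det_transpose, ← sq, ← sq_abs, o.volumeForm_robust' b, sq_abs,
    Basis.det_apply]

theorem sum_volumeForm_sq {n : ℕ} [Fact (finrank ℝ T = n)] (o : Orientation ℝ T (Fin n))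
    {N : ℕ} (hN : N = n) (b : OrthonormalBasis (Fin N) ℝ T) :
    ∑ f : Fin n → Fin N, o.volumeForm (fun i => b (f i)) ^ 2 = (n.factorial : ℝ) := by
  subst hN
  have hterm (f : Fin N → Fin N) : o.volumeForm (fun i => b (f i)) ^ 2 =
      if Function.Injective f then 1 else 0 := by
    split_ifs with hf
    · let τ : Equiv.Perm (Fin N) := Equiv.ofBijective f (Finite.injective_iff_bijective.1 hf)
      have hτ : (fun i => b (f i)) = b.reindex τ.symm := by
        funext i
        simp [τ]
      rw [hτ, ← sq_abs, o.abs_volumeForm_apply_of_orthonormal, one_pow]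
    · obtain ⟨i, j, hij, hne⟩ := Function.not_injective_iff.1 hf
      rw [o.volumeForm.map_eq_zero_of_eq _ (i := i) (j := j) (by rw [hij]) hne, sq, mul_zero]
  simp_rw [hterm, Finset.sum_boole]
  rw [← Fintype.card_subtype, Fintype.card_congr (Equiv.subtypeInjectiveEquivEmbedding _ _),
    Fintype.card_embedding_eq, Fintype.card_fin, Nat.descFactorial_self]

end InnerProduct

section LieCoordinates

variable {E : Type*} [NormedAddCommGroup E] [NormedSpace ℝ E]

theorem fderivWithin_compContinuousLinearMap_apply {F G H : Type*}
    [NormedAddCommGroup F] [NormedSpace ℝ F] [NormedAddCommGroup G] [NormedSpace ℝ G]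
    [NormedAddCommGroup H] [NormedSpace ℝ H] {k : ℕ} {s : Set E} {y : E}
    {f : E → G [⋀^Fin k]→L[ℝ] H} {L : E → F →L[ℝ] G} (hs : UniqueDiffWithinAt ℝ s y)
    (hf : DifferentiableWithinAt ℝ f s y) (hL : DifferentiableWithinAt ℝ L s y)
    (u : E) (w : Fin k → F) :
    fderivWithin ℝ (fun z => (f z).compContinuousLinearMap (L z)) s y u w =
      fderivWithin ℝ f s y u (L y ∘ w) +
        ∑ j, f y (Function.update (L y ∘ w) j (fderivWithin ℝ L s y u (w j))) := by
  rw [fderivWithin_continuousAlternatingMapCompContinuousLinearMap hf hL hs]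
  have hupdate (j : Fin k) : (fun i => (Function.update (fun _ => L y) j (fderivWithin ℝ L s y u) :
      Fin k → F →L[ℝ] G) i (w i)) = Function.update (L y ∘ w) j (fderivWithin ℝ L s y u (w j)) := by
    funext i
    rcases eq_or_ne i j with rfl | hij
    · simp
    · simp [hij]
  simp only [_root_.add_apply, ContinuousAlternatingMap.add_apply, ContinuousLinearMap.comp_apply,
    ContinuousAlternatingMap.compContinuousLinearMapCLM_apply,
    ContinuousAlternatingMap.compContinuousLinearMap_apply,
    ContinuousAlternatingMap.fderivCompContinuousLinearMap_apply, hupdate]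

theorem fderivWithin_apply_of_related {s t : Set E} {φ X₁ X₂ : E → E} {y : E}
    (hs : UniqueDiffWithinAt ℝ s y) (hys : y ∈ s) (hφ : DifferentiableWithinAt ℝ φ s y)
    (hdφ : DifferentiableWithinAt ℝ (fderivWithin ℝ φ s) s y) (hst : MapsTo φ s t)
    (hX₁ : DifferentiableWithinAt ℝ X₁ s y) (hX₂ : DifferentiableWithinAt ℝ X₂ t (φ y))
    (hX : ∀ᶠ z in 𝓝[s] y, X₂ (φ z) = fderivWithin ℝ φ s z (X₁ z)) (w : E) :
    fderivWithin ℝ X₂ t (φ y) (fderivWithin ℝ φ s y w) =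
      fderivWithin ℝ φ s y (fderivWithin ℝ X₁ s y w) +
        fderivWithin ℝ (fderivWithin ℝ φ s) s y w (X₁ y) := by
  have h : fderivWithin ℝ (fun z => X₂ (φ z)) s y =
      fderivWithin ℝ (fun z => fderivWithin ℝ φ s z (X₁ z)) s y :=
    EventuallyEq.fderivWithin_eq_of_mem hX hys
  rw [fderivWithin_fun_comp _ hX₂ hφ hst hs, fderivWithin_clm_apply hs hdφ hX₁] at h
  simpa using congrArg (fun L => L w) h

variable [FiniteDimensional ℝ E]

/-- The Lie derivative, in coordinates, of the form `b` along the vector field `X`. The set `s` is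
the coordinate half-space, up to whose boundary derivatives are taken. -/
def lieCoord {k : ℕ} (s : Set E) (X : E → E) (b : E → E [⋀^Fin k]→L[ℝ] ℝ) (y : E) :
    E [⋀^Fin k]→L[ℝ] ℝ :=
  fderivWithin ℝ b s y (X y) + derivAct (fderivWithin ℝ X s y).toLinearMap (b y)

/- The second derivatives of `φ` coming from the form and from the vector field agree by symmetry
and cancel. -/
theorem lieCoord_pullback {k : ℕ} {s t : Set E} {φ : E → E} {X₁ X₂ : E → E}
    {b₁ b₂ : E → E [⋀^Fin k]→L[ℝ] ℝ} {y : E} (hs : UniqueDiffOn ℝ s) (hys : y ∈ s)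
    (hyc : y ∈ closure (interior s)) (hφ : ContDiffWithinAt ℝ ∞ φ s y) (hst : MapsTo φ s t)
    (hX₁ : DifferentiableWithinAt ℝ X₁ s y) (hX₂ : DifferentiableWithinAt ℝ X₂ t (φ y))
    (hb₂ : DifferentiableWithinAt ℝ b₂ t (φ y))
    (hb : ∀ᶠ z in 𝓝[s] y, b₁ z = (b₂ (φ z)).compContinuousLinearMap (fderivWithin ℝ φ s z))
    (hX : ∀ᶠ z in 𝓝[s] y, X₂ (φ z) = fderivWithin ℝ φ s z (X₁ z)) :
    lieCoord s X₁ b₁ y =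
      (lieCoord t X₂ b₂ (φ y)).compContinuousLinearMap (fderivWithin ℝ φ s y) := by
  have hφ' : DifferentiableWithinAt ℝ φ s y := hφ.differentiableWithinAt (by simp)
  have hdφ : DifferentiableWithinAt ℝ (fderivWithin ℝ φ s) s y :=
    (hφ.fderivWithin_right (m := 1) hs (by norm_cast) hys).differentiableWithinAt one_ne_zero
  have hsymm : IsSymmSndFDerivWithinAt ℝ φ s y :=
    hφ.isSymmSndFDerivWithinAt (by simp; norm_cast) hs hyc hys
  have hu := hs y hys
  ext w
  have hdb : fderivWithin ℝ b₁ s y (X₁ y) w = fderivWithin ℝ b₂ t (φ y) (X₂ (φ y))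
        (fderivWithin ℝ φ s y ∘ w) + ∑ j, b₂ (φ y) (Function.update (fderivWithin ℝ φ s y ∘ w) j
          (fderivWithin ℝ (fderivWithin ℝ φ s) s y (X₁ y) (w j))) := by
    rw [EventuallyEq.fderivWithin_eq_of_mem hb hys, hX.self_of_nhdsWithin hys,
      fderivWithin_compContinuousLinearMap_apply (f := fun z => b₂ (φ z)) hu
        (hb₂.comp y hφ' hst) hdφ, fderivWithin_fun_comp _ hb₂ hφ' hst hu]
    rfl
  have hdX := fderivWithin_apply_of_related hu hys hφ' hdφ hst hX₁ hX₂ hX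
  simp only [lieCoord, ContinuousAlternatingMap.add_apply, derivAct_apply, hdb,
    ContinuousAlternatingMap.compContinuousLinearMap_apply, hb.self_of_nhdsWithin hys, add_assoc,
    ContinuousLinearMap.coe_coe, ← Finset.sum_add_distrib]
  refine congrArg₂ (· + ·) rfl (Finset.sum_congr rfl fun j _ => ?_)
  rw [Function.comp_update, Function.comp_apply, hdX, ContinuousAlternatingMap.map_update_add,
    hsymm.eq (X₁ y) (w j), add_comm]

end LieCoordinates

variable {m : ℕ} {M : Type*} [TopologicalSpace M] [ChartedSpace (EuclideanHalfSpace (m + 1)) M]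

local notation "𝔼" => EuclideanSpace ℝ (Fin (m + 1))
local notation "ℍ" => range (𝓡∂ (m + 1))
local notation "φ" => extChartAt (M := M) (𝓡∂ (m + 1))

section Charts

variable {i j : M} {y : EuclideanSpace ℝ (Fin (m + 1))}

/-- The `j`-th vector of the standard basis of the model space. -/
def stdE (m : ℕ) (j : Fin (m + 1)) : EuclideanSpace ℝ (Fin (m + 1)) :=
  EuclideanSpace.single j 1

variable (m) in
theorem coe_basisFun_toBasis :
    ⇑(EuclideanSpace.basisFun (Fin (m + 1)) ℝ).toBasis = stdE m := by
  funext j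
  simp [stdE]

theorem sum_smul_stdE (u : 𝔼) : ∑ j, u j • stdE m j = u := by
  simpa [stdE] using (EuclideanSpace.basisFun (Fin (m + 1)) ℝ).sum_repr u

/-- The coordinate change from the chart at `i` to the chart at `j`. -/
def coordChange (i j : M) : 𝔼 → 𝔼 := φ j ∘ (φ i).symm

theorem mapsTo_coordChange (i j : M) (s : Set 𝔼) : MapsTo (coordChange i j) s ℍ := fun y _ => by
  simp [coordChange, extChartAt]

theorem mem_range_of_mem_target (hy : y ∈ (φ i).target) : y ∈ ℍ :=
  extChartAt_target_subset_range i hy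

theorem uniqueDiffWithinAt_of_mem_target (hy : y ∈ (φ i).target) : UniqueDiffWithinAt ℝ ℍ y :=
  (𝓡∂ (m + 1)).uniqueDiffOn y (mem_range_of_mem_target hy)

theorem fderivWithin_range_eq_target {F : Type*} [NormedAddCommGroup F] [NormedSpace ℝ F]
    {f : 𝔼 → F} (hy : y ∈ (φ i).target) :
    fderivWithin ℝ f ℍ y = fderivWithin ℝ f (φ i).target y :=
  fderivWithin_congr_set (nhdsWithin_eq_iff_eventuallyEq.1
    (nhdsWithin_extChartAt_target_eq_of_mem hy).symm)

theorem contDiffWithinAt_range_of_contDiffOn {F : Type*} [NormedAddCommGroup F]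
    [NormedSpace ℝ F] {f : 𝔼 → F} (hf : ContDiffOn ℝ ∞ f (φ i).target)
    (hy : y ∈ (φ i).target) : ContDiffWithinAt ℝ ∞ f ℍ y :=
  (hf y hy).mono_of_mem_nhdsWithin (extChartAt_target_mem_nhdsWithin_of_mem hy)

theorem differentiableWithinAt_range_of_contDiffOn {F : Type*} [NormedAddCommGroup F]
    [NormedSpace ℝ F] {f : 𝔼 → F} (hf : ContDiffOn ℝ ∞ f (φ i).target)
    (hy : y ∈ (φ i).target) : DifferentiableWithinAt ℝ f ℍ y :=
  (contDiffWithinAt_range_of_contDiffOn hf hy).differentiableWithinAt (by simp)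

theorem contDiffOn_fderivWithin_range {F : Type*} [NormedAddCommGroup F] [NormedSpace ℝ F]
    {f : 𝔼 → F} (hf : ContDiffOn ℝ ∞ f (φ i).target) :
    ContDiffOn ℝ ∞ (fderivWithin ℝ f ℍ) (φ i).target :=
  (hf.fderivWithin (uniqueDiffOn_extChartAt_target i) (by simp)).congr
    fun _ hy => fderivWithin_range_eq_target hy

theorem eventually_mem_overlap (hy : y ∈ (φ i).target) (hj : (φ i).symm y ∈ (φ j).source) :
    ∀ᶠ z in 𝓝[ℍ] y, z ∈ (φ i).target ∧ (φ i).symm z ∈ (φ j).source := by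
  have hmem := extChartAt_target_mem_nhdsWithin_of_mem hy
  have hcont : ContinuousWithinAt (φ i).symm ℍ y :=
    ((continuousOn_extChartAt_symm i) y hy).mono_of_mem_nhdsWithin hmem
  exact (eventually_mem_set.2 hmem).and (hcont ((isOpen_extChartAt_source j).mem_nhds hj))

/-- Smoothness of a vector field: its components in each chart are smooth up to the boundary. -/
def IsSmoothV (v : VField m M) : Prop :=
  ∀ i : M, ContDiffOn ℝ ∞ (vInChart v i) (φ i).target

theorem vInChart_extChartAt (v : VField m M) {x : M} (hx : x ∈ (φ i).source) :
    vInChart v i (φ i x) = dChart i x (v x) := by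
  obtain ⟨y, hy, rfl⟩ : ∃ y ∈ (φ i).target, (φ i).symm y = x :=
    ⟨_, (φ i).map_source hx, (φ i).left_inv hx⟩
  rw [(φ i).right_inv hy]
  rfl

variable [IsManifold (𝓡∂ (m + 1)) ∞ M]

theorem dChartSymm_dChart (hy : y ∈ (φ i).target)
    (w : TangentSpace (𝓡∂ (m + 1)) ((φ i).symm y)) :
    dChartSymm i y (dChart i ((φ i).symm y) w) = w :=
  congrArg (fun L => L w) (mfderivWithin_extChartAt_symm_comp_mfderiv_extChartAt hy)

theorem dChartSymm_vInChart (v : VField m M) (hy : y ∈ (φ i).target) :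
    dChartSymm i y (vInChart v i y) = v ((φ i).symm y) :=
  dChartSymm_dChart hy _

theorem eq_inChart_comp {k : ℕ} (β : DForm m M k) {x : M} (hx : x ∈ (φ i).source) :
    β x = (inChart β i (φ i x)).compContinuousLinearMap (dChart i x) := by
  obtain ⟨y, hy, rfl⟩ : ∃ y ∈ (φ i).target, (φ i).symm y = x :=
    ⟨_, (φ i).map_source hx, (φ i).left_inv hx⟩
  rw [(φ i).right_inv hy]
  ext w
  exact congrArg (β _) (funext fun l => (dChartSymm_dChart hy (w l)).symm)

theorem contDiffWithinAt_coordChange (hy : y ∈ (φ i).target)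
    (hj : (φ i).symm y ∈ (φ j).source) : ContDiffWithinAt ℝ ∞ (coordChange i j) ℍ y :=
  contDiffWithinAt_ext_coord_change j i (by
    rw [PartialEquiv.trans_source]
    exact ⟨hy, hj⟩)

theorem fderivWithin_coordChange (hy : y ∈ (φ i).target) (hj : (φ i).symm y ∈ (φ j).source)
    (w : 𝔼) :
    fderivWithin ℝ (coordChange i j) ℍ y w = dChart j ((φ i).symm y) (dChartSymm i y w) := by
  have h := mfderiv_comp_mfderivWithin (I := 𝓘(ℝ, 𝔼)) (I' := 𝓡∂ (m + 1)) (I'' := 𝓘(ℝ, 𝔼))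
    (f := (φ i).symm) (g := φ j) (s := ℍ) y
    (mdifferentiableAt_extChartAt (by rwa [← extChartAt_source (𝓡∂ (m + 1))]))
    (mdifferentiableWithinAt_extChartAt_symm hy)
    ((𝓡∂ (m + 1)).uniqueMDiffOn _ (mem_range_of_mem_target hy))
  rw [← mfderivWithin_eq_fderivWithin]
  exact congrArg (fun L => L w) h

theorem inChart_coordChange {k : ℕ} (β : DForm m M k) (hy : y ∈ (φ i).target)
    (hj : (φ i).symm y ∈ (φ j).source) :
    inChart β i y = (inChart β j (coordChange i j y)).compContinuousLinearMap
      (fderivWithin ℝ (coordChange i j) ℍ y) := by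
  ext w
  conv_lhs => rw [inChart, eq_inChart_comp β hj]
  exact congrArg (inChart β j (coordChange i j y))
    (funext fun l => (fderivWithin_coordChange hy hj (w l)).symm)

theorem vInChart_coordChange (v : VField m M) (hy : y ∈ (φ i).target)
    (hj : (φ i).symm y ∈ (φ j).source) :
    vInChart v j (coordChange i j y) =
      fderivWithin ℝ (coordChange i j) ℍ y (vInChart v i y) := by
  rw [fderivWithin_coordChange hy hj, dChartSymm_vInChart v hy]
  exact vInChart_extChartAt v hj

theorem inChart_lieD {k : ℕ} {v : VField m M} {β : DForm m M k} (hv : IsSmoothV v)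
    (hβ : IsSmooth β) (hy : y ∈ (φ i).target) :
    inChart (lieD v β) i y = lieCoord ℍ (vInChart v i) (inChart β i) y := by
  set x : M := (φ i).symm y
  have hj : (φ i).symm y ∈ (φ x).source := mem_extChartAt_source x
  have hyr := mem_range_of_mem_target hy
  have hx0 : coordChange i x y ∈ (φ x).target := (φ x).map_source hj
  have hov := eventually_mem_overlap hy hj
  rw [lieCoord_pullback (𝓡∂ (m + 1)).uniqueDiffOn hyr
    ((𝓡∂ (m + 1)).range_subset_closure_interior hyr) (contDiffWithinAt_coordChange hy hj)
    (mapsTo_coordChange i x _) (differentiableWithinAt_range_of_contDiffOn (hv i) hy)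
    (differentiableWithinAt_range_of_contDiffOn (hv x) hx0)
    (differentiableWithinAt_range_of_contDiffOn (hβ x) hx0)
    (hov.mono fun z hz => inChart_coordChange β hz.1 hz.2)
    (hov.mono fun z hz => vInChart_coordChange v hz.1 hz.2)]
  ext w
  exact congrArg (lieCoord ℍ (vInChart v x) (inChart β x) (coordChange i x y))
    (funext fun l => (fderivWithin_coordChange hy hj (w l)).symm)

end Charts

section Smoothness

-- A shortcut: instance search runs out of heartbeats without it.
instance instT2SpaceModel : T2Space 𝔼 := TopologicalSpace.t2Space_of_metrizableSpace

variable {i j : M} {y : EuclideanSpace ℝ (Fin (m + 1))}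

/-- The coordinate expression of a function in the chart at `i`. -/
def fInChart (f : M → ℝ) (i : M) (y : 𝔼) : ℝ := f ((φ i).symm y)

/-- The function underlying a `0`-form. -/
def fval (f : DForm m M 0) (x : M) : ℝ := f x Fin.elim0

/-- The determinant form of the standard basis of the model space. -/
def stdDet (m : ℕ) : EuclideanSpace ℝ (Fin (m + 1)) [⋀^Fin (m + 1)]→L[ℝ] ℝ :=
  toCont (EuclideanSpace.basisFun (Fin (m + 1)) ℝ).toBasis.det

theorem stdDet_stdE : stdDet m (stdE m) = 1 := by
  rw [stdDet, toCont_apply, ← coe_basisFun_toBasis, Basis.det_self]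

/-- The coefficient of a top form in the chart at `i`. -/
def topCoef (β : DForm m M (m + 1)) (i : M) (y : 𝔼) : ℝ := inChart β i y (stdE m)

theorem topCoef_fsmul (f : DForm m M 0) (β : DForm m M (m + 1)) :
    topCoef (fsmul f β) i y = fInChart (fval f) i y * topCoef β i y := rfl

theorem topCoef_eq_zero {β : DForm m M (m + 1)} (h : β ((φ i).symm y) = 0) :
    topCoef β i y = 0 := by
  rw [topCoef, inChart, h]
  rfl

theorem inChart_sum {k : ℕ} {ι : Type*} (s : Finset ι) (β : ι → DForm m M k) :
    inChart (∑ a ∈ s, β a) i y = ∑ a ∈ s, inChart (β a) i y := by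
  ext u
  rw [inChart, ContinuousAlternatingMap.compContinuousLinearMap_apply, Finset.sum_apply,
    ContinuousAlternatingMap.sum_apply, ContinuousAlternatingMap.sum_apply]
  rfl

theorem topCoef_sum {ι : Type*} (s : Finset ι) (β : ι → DForm m M (m + 1)) :
    topCoef (∑ a ∈ s, β a) i y = ∑ a ∈ s, topCoef (β a) i y := by
  rw [topCoef, inChart_sum, ContinuousAlternatingMap.sum_apply]
  rfl

theorem inChart_zero_eq (f : DForm m M 0) :
    inChart f i y = ContinuousAlternatingMap.constOfIsEmpty ℝ 𝔼 (Fin 0)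
       (fInChart (fval f) i y) := by
  ext w
  exact congrArg (f _) (Subsingleton.elim _ _)

theorem inChart_top_eq (β : DForm m M (m + 1)) :
    inChart β i y = topCoef β i y • stdDet m := by
  refine topForm_ext (EuclideanSpace.basisFun (Fin (m + 1)) ℝ).toBasis ?_
  rw [coe_basisFun_toBasis, ContinuousAlternatingMap.smul_apply, stdDet_stdE, smul_eq_mul, mul_one,
    topCoef]

theorem contDiffOn_apply {E : Type*} [NormedAddCommGroup E] [NormedSpace ℝ E] {k : ℕ}
    {β : E → E [⋀^Fin k]→L[ℝ] ℝ} {s : Set E} (h : ContDiffOn ℝ ∞ β s) (v : Fin k → E) :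
    ContDiffOn ℝ ∞ (fun y => β y v) s :=
  (ContinuousAlternatingMap.apply ℝ _ ℝ v).contDiff.comp_contDiffOn h

theorem isSmooth_zero_iff {f : DForm m M 0} :
    IsSmooth f ↔ ∀ i : M, ContDiffOn ℝ ∞ (fInChart (fval f) i) (φ i).target := by
  let e := ContinuousAlternatingMap.constOfIsEmptyLIE ℝ 𝔼 ℝ (Fin 0)
  refine forall_congr' fun i => ⟨fun h => ?_, fun h => ?_⟩
  · exact (e.symm.contDiff.comp_contDiffOn h).congr fun y _ => by simp [e, inChart_zero_eq]
  · exact (e.contDiff.comp_contDiffOn h).congr fun y _ => inChart_zero_eq f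

theorem isSmooth_top_iff {β : DForm m M (m + 1)} :
    IsSmooth β ↔ ∀ i : M, ContDiffOn ℝ ∞ (topCoef β i) (φ i).target := by
  refine forall_congr' fun i => ⟨fun h => contDiffOn_apply h _, fun h => ?_⟩
  exact (h.smul contDiffOn_const).congr fun y _ => inChart_top_eq β

theorem IsSmooth.fsmul {k : ℕ} {f : DForm m M 0} {β : DForm m M k} (hf : IsSmooth f)
    (hβ : IsSmooth β) : IsSmooth (fsmul f β) := fun i =>
  (isSmooth_zero_iff.1 hf i).smul (hβ i)

theorem IsSmooth.sum {k : ℕ} {ι : Type*} {s : Finset ι} {β : ι → DForm m M k}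
    (hβ : ∀ a ∈ s, IsSmooth (β a)) : IsSmooth (∑ a ∈ s, β a) := fun i =>
  (ContDiffOn.sum fun a ha => hβ a ha i).congr fun _ _ => inChart_sum s β

theorem IsSmooth.neg {k : ℕ} {β : DForm m M k} (hβ : IsSmooth β) : IsSmooth (-β) := fun i =>
  (hβ i).neg

theorem wedge_add_left {k l r : ℕ} (h : k + l = r) (α α' : DForm m M k) (β : DForm m M l) :
    wedge h (α + α') β = wedge h α β + wedge h α' β :=
  funext fun x => wedgeAt_add_left h (α x) (α' x) (β x)

theorem wedge_neg_left {k l r : ℕ} (h : k + l = r) (α : DForm m M k) (β : DForm m M l) :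
    wedge h (-α) β = -wedge h α β :=
  (AddMonoidHom.mk' (fun α => wedge h α β) fun α α' => wedge_add_left h α α' β).map_neg α

theorem wedge_zero_left {l : ℕ} (h : 0 + l = l) (f : DForm m M 0) (β : DForm m M l) :
    wedge h f β = fsmul f β := funext fun x => wedgeAt_zero_left h (f x) (β x)

theorem wedge_zero_right {k : ℕ} (h : k + 0 = k) (α : DForm m M k) (f : DForm m M 0) :
    wedge h α f = fsmul f α := funext fun x => wedgeAt_zero_right h (α x) (f x)

theorem extDerivWithin_inChart_zero (f : DForm m M 0) (hy : UniqueDiffWithinAt ℝ ℍ y) :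
    extDerivWithin (inChart f i) ℍ y = ContinuousAlternatingMap.ofSubsingleton ℝ _ ℝ (0 : Fin 1)
      (fderivWithin ℝ (fInChart (fval f) i) ℍ y) := by
  rw [← extDerivWithin_constOfIsEmpty _ hy]
  exact congrArg (extDerivWithin · ℍ y) (funext fun _ => inChart_zero_eq f)

/-- The contraction `ι_v β` of a form with a vector field. -/
def contract {k : ℕ} (v : VField m M) (β : DForm m M (k + 1)) : DForm m M k :=
  fun x => interiorAt (v x) (β x)

theorem contract_fsmul {k : ℕ} (f : DForm m M 0) (v : VField m M) (β : DForm m M (k + 1)) :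
    contract v (fsmul f β) = fsmul f (contract v β) := rfl

theorem fsmul_fsmul_comm {k : ℕ} (f g : DForm m M 0) (β : DForm m M k) :
    fsmul (fsmul f g) β = fsmul g (fsmul f β) :=
  funext fun x => (congrArg (· • β x) (mul_comm (fval f x) (fval g x))).trans (mul_smul _ _ _)

theorem contract_extD_zero (v : VField m M) (f : DForm m M 0) :
    contract v (extD f) = lieD v f := by
  funext x
  have hx := uniqueDiffWithinAt_of_mem_target (mem_extChartAt_target (I := 𝓡∂ (m + 1)) x)
  have hf : inChart f x =
      ContinuousAlternatingMap.constOfIsEmptyLIE ℝ 𝔼 ℝ (Fin 0) ∘ fInChart (fval f) x :=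
    funext fun _ => inChart_zero_eq f
  ext w
  rw [contract, interiorAt_apply, extD, extDerivWithin_inChart_zero f hx, lieD,
    ContinuousAlternatingMap.compContinuousLinearMap_apply,
    ContinuousAlternatingMap.compContinuousLinearMap_apply, ContinuousAlternatingMap.add_apply,
    derivAct_apply, hf, LinearIsometryEquiv.comp_fderivWithin _ hx,
    vInChart_extChartAt v (mem_extChartAt_source x)]
  simp

theorem apply_update_basis {n : ℕ} {T : Type*} [AddCommGroup T] [Module ℝ T] [TopologicalSpace T]
    (e : Basis (Fin n) ℝ T) (b : T [⋀^Fin n]→L[ℝ] ℝ) (j : Fin n) (u : T) :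
    b (Function.update e j u) = e.repr u j * b e := by
  conv_lhs => rw [← e.sum_repr u]
  have hoff (k : Fin n) (hk : k ≠ j) : b (Function.update e j (e k)) = 0 :=
    b.map_eq_zero_of_eq _ (i := j) (j := k) (by simp [hk]) hk.symm
  change b.toMultilinearMap _ = _
  rw [MultilinearMap.map_update_sum, Finset.sum_eq_single j]
  · rw [MultilinearMap.map_update_smul, Function.update_eq_self]
    rfl
  · intro k _ hk
    rw [MultilinearMap.map_update_smul]
    exact (congrArg (e.repr u k • ·) (hoff k hk)).trans (smul_zero _)
  · simp

theorem apply_comp_basis {n : ℕ} {T : Type*} [AddCommGroup T] [Module ℝ T] [TopologicalSpace T]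
    (e : Basis (Fin n) ℝ T) (b : T [⋀^Fin n]→L[ℝ] ℝ) (L : T →ₗ[ℝ] T) :
    b (L ∘ e) = LinearMap.det L * b e := by
  have h (v : Fin n → T) : b v = b e * e.det v :=
    congrArg (fun f => f v) (b.toAlternatingMap.eq_smul_basis_det e)
  rw [h, e.det_comp, e.det_self, mul_one, mul_comm]

/-- The divergence of a vector field on the half-space, with derivatives taken up to the
boundary. -/
def divCoord (X : 𝔼 → 𝔼) (y : 𝔼) : ℝ := ∑ j, fderivWithin ℝ X ℍ y (stdE m j) j

theorem divCoord_smul {f : 𝔼 → ℝ} {X : 𝔼 → 𝔼} (hy : UniqueDiffWithinAt ℝ ℍ y)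
    (hf : DifferentiableWithinAt ℝ f ℍ y) (hX : DifferentiableWithinAt ℝ X ℍ y) :
    divCoord (fun z => f z • X z) y = fderivWithin ℝ f ℍ y (X y) + f y * divCoord X y := by
  conv_rhs => rw [← sum_smul_stdE (X y), map_sum]
  rw [divCoord, divCoord, Finset.mul_sum, ← Finset.sum_add_distrib, fderivWithin_fun_smul hy hf hX]
  refine Finset.sum_congr rfl fun j _ => ?_
  simp only [_root_.add_apply, _root_.smul_apply, PiLp.add_apply, PiLp.smul_apply,
    ContinuousLinearMap.smulRight_apply, smul_eq_mul, map_smul]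
  ring

theorem divCoord_sum {ι : Type*} {s : Finset ι} {X : ι → 𝔼 → 𝔼} (hy : UniqueDiffWithinAt ℝ ℍ y)
    (hX : ∀ a ∈ s, DifferentiableWithinAt ℝ (X a) ℍ y) :
    divCoord (fun z => ∑ a ∈ s, X a z) y = ∑ a ∈ s, divCoord (X a) y := by
  simp only [divCoord, fderivWithin_fun_sum hy hX]
  rw [Finset.sum_comm]
  refine Finset.sum_congr rfl fun j _ => ?_
  rw [_root_.sum_apply]
  exact map_sum (EuclideanSpace.proj j : 𝔼 →L[ℝ] ℝ) _ _

theorem divCoord_congr {X Y : 𝔼 → 𝔼} (h : X =ᶠ[𝓝[ℍ] y] Y) (hy : y ∈ ℍ) :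
    divCoord X y = divCoord Y y := by
  rw [divCoord, divCoord, h.fderivWithin_eq_of_mem hy]

theorem divCoord_zero : divCoord (fun _ : 𝔼 => (0 : 𝔼)) y = 0 := by
  simp [divCoord]

theorem contDiffOn_divCoord {X : 𝔼 → 𝔼} (hX : ContDiffOn ℝ ∞ X (φ i).target) :
    ContDiffOn ℝ ∞ (divCoord X) (φ i).target :=
  ContDiffOn.sum fun j _ => (EuclideanSpace.proj j : _ →L[ℝ] ℝ).contDiff.comp_contDiffOn
    ((contDiffOn_fderivWithin_range hX).clm_apply contDiffOn_const)

variable [IsManifold (𝓡∂ (m + 1)) ∞ M]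

theorem topForm_eq_of_topCoef {β γ : DForm m M (m + 1)}
    (h : ∀ i : M, ∀ y ∈ (φ i).target, topCoef β i y = topCoef γ i y) : β = γ := by
  funext x
  rw [eq_inChart_comp β (mem_extChartAt_source x), eq_inChart_comp γ (mem_extChartAt_source x),
    inChart_top_eq, inChart_top_eq, h x _ (mem_extChartAt_target x)]

theorem topCoef_coordChange (β : DForm m M (m + 1)) (hy : y ∈ (φ i).target)
    (hj : (φ i).symm y ∈ (φ j).source) :
    topCoef β i y = (fderivWithin ℝ (coordChange i j) ℍ y).det *
      topCoef β j (coordChange i j y) := by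
  rw [topCoef, inChart_coordChange β hy hj, topCoef, ← coe_basisFun_toBasis]
  exact apply_comp_basis (EuclideanSpace.basisFun (Fin (m + 1)) ℝ).toBasis
    (inChart β j (coordChange i j y)) (fderivWithin ℝ (coordChange i j) ℍ y).toLinearMap

theorem inChart_contract {k : ℕ} (v : VField m M) (β : DForm m M (k + 1))
    (hy : y ∈ (φ i).target) :
    inChart (contract v β) i y = interiorAt (vInChart v i y) (inChart β i y) := by
  ext u
  refine congrArg (β ((φ i).symm y)) (funext fun l => Fin.cases ?_ (fun _ => rfl) l)
  exact (dChartSymm_vInChart v hy).symm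

theorem contDiff_curryLeft {E : Type*} [NormedAddCommGroup E] [NormedSpace ℝ E] {k : ℕ} :
    ContDiff ℝ ∞ (fun β : E [⋀^Fin (k + 1)]→L[ℝ] ℝ => β.curryLeft) :=
  IsBoundedLinearMap.contDiff
    ⟨⟨ContinuousAlternatingMap.curryLeft_add, ContinuousAlternatingMap.curryLeft_smul⟩, 1, one_pos,
      fun β => by simp⟩

theorem IsSmooth.contract {k : ℕ} {v : VField m M} {β : DForm m M (k + 1)} (hv : IsSmoothV v)
    (hβ : IsSmooth β) : IsSmooth (contract v β) := fun i =>
  ((contDiff_curryLeft.comp_contDiffOn (hβ i)).clm_apply (hv i)).congr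
    fun _ hy => inChart_contract v β hy

theorem inChart_extD_zero {f : DForm m M 0} (hf : IsSmooth f) (hy : y ∈ (φ i).target) :
    inChart (extD f) i y = ContinuousAlternatingMap.ofSubsingleton ℝ _ ℝ (0 : Fin 1)
      (fderivWithin ℝ (fInChart (fval f) i) ℍ y) := by
  set x : M := (φ i).symm y
  have hj : (φ i).symm y ∈ (φ x).source := mem_extChartAt_source x
  have hyr := mem_range_of_mem_target hy
  have hx0 : coordChange i x y ∈ (φ x).target := (φ x).map_source hj
  have hcomp : fInChart (fval f) i =ᶠ[𝓝[ℍ] y]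
      fun z => fInChart (fval f) x (coordChange i x z) :=
    (eventually_mem_overlap hy hj).mono fun z hz =>
      (congrArg (fval f) ((φ x).left_inv hz.2)).symm
  rw [hcomp.fderivWithin_eq_of_mem hyr, fderivWithin_fun_comp _
    (differentiableWithinAt_range_of_contDiffOn (isSmooth_zero_iff.1 hf x) hx0)
    ((contDiffWithinAt_coordChange hy hj).differentiableWithinAt (by simp))
    (mapsTo_coordChange i x _) (uniqueDiffWithinAt_of_mem_target hy)]
  ext w
  change extD f x (fun l => dChartSymm i y (w l)) =
    fderivWithin ℝ (fInChart (fval f) x) _ _ (fderivWithin ℝ (coordChange i x) _ y (w 0))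
  rw [extD, extDerivWithin_inChart_zero f
    (uniqueDiffWithinAt_of_mem_target (mem_extChartAt_target x)), fderivWithin_coordChange hy hj]
  rfl

theorem IsSmooth.extD_zero {f : DForm m M 0} (hf : IsSmooth f) : IsSmooth (extD f) := fun i =>
  ((ContinuousAlternatingMap.ofSubsingletonLIE (𝕜 := ℝ) (E := 𝔼) (F := ℝ)
    (0 : Fin 1)).contDiff.comp_contDiffOn (contDiffOn_fderivWithin_range
      (isSmooth_zero_iff.1 hf i))).congr fun _ hy => inChart_extD_zero hf hy

theorem fInChart_lieD_zero {f : DForm m M 0} (hf : IsSmooth f) (v : VField m M)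
    (hy : y ∈ (φ i).target) :
    fInChart (fval (lieD v f)) i y = fderivWithin ℝ (fInChart (fval f) i) ℍ y (vInChart v i y) := by
  rw [← contract_extD_zero]
  have h := inChart_contract v (extD f) hy
  rw [inChart_extD_zero hf hy] at h
  exact congrArg (· Fin.elim0) ((inChart_zero_eq _).symm.trans h)

theorem topCoef_lieD {v : VField m M} {β : DForm m M (m + 1)} (hv : IsSmoothV v)
    (hβ : IsSmooth β) (hy : y ∈ (φ i).target) :
    topCoef (lieD v β) i y = divCoord (fun z => topCoef β i z • vInChart v i z) y := by
  have hu := uniqueDiffWithinAt_of_mem_target hy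
  rw [divCoord_smul hu (differentiableWithinAt_range_of_contDiffOn (isSmooth_top_iff.1 hβ i) hy)
    (differentiableWithinAt_range_of_contDiffOn (hv i) hy), topCoef, inChart_lieD hv hβ hy,
    lieCoord, ContinuousAlternatingMap.add_apply, derivAct_apply]
  congr 1
  · exact (fderivWithin_continuousAlternatingMap_apply_const_apply hu
      (differentiableWithinAt_range_of_contDiffOn (hβ i) hy) _ _).symm
  · rw [divCoord, Finset.mul_sum]
    refine Finset.sum_congr rfl fun j _ => ?_
    have h := apply_update_basis (EuclideanSpace.basisFun (Fin (m + 1)) ℝ).toBasis (inChart β i y) j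
      (fderivWithin ℝ (vInChart v i) ℍ y (stdE m j))
    rw [coe_basisFun_toBasis, mul_comm] at h
    exact h

theorem IsSmooth.lieD_top {v : VField m M} {β : DForm m M (m + 1)} (hv : IsSmoothV v)
    (hβ : IsSmooth β) : IsSmooth (lieD v β) :=
  isSmooth_top_iff.2 fun i => (contDiffOn_divCoord ((isSmooth_top_iff.1 hβ i).smul (hv i))).congr
    fun _ hy => topCoef_lieD hv hβ hy

theorem IsSmooth.lieD_zero {v : VField m M} {f : DForm m M 0} (hv : IsSmoothV v)
    (hf : IsSmooth f) : IsSmooth (lieD v f) :=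
  contract_extD_zero v f ▸ hf.extD_zero.contract hv

theorem lieD_sum_top {ι : Type*} {s : Finset ι} {v : VField m M} {β : ι → DForm m M (m + 1)}
    (hv : IsSmoothV v) (hβ : ∀ a ∈ s, IsSmooth (β a)) :
    lieD v (∑ a ∈ s, β a) = ∑ a ∈ s, lieD v (β a) := by
  refine topForm_eq_of_topCoef fun i y hy => ?_
  have hW (a : ι) (ha : a ∈ s) :
      ContDiffOn ℝ ∞ (fun z => topCoef (β a) i z • vInChart v i z) (φ i).target :=
    (isSmooth_top_iff.1 (hβ a ha) i).smul (hv i)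
  rw [topCoef_lieD hv (.sum hβ) hy, topCoef_sum,
    Finset.sum_congr rfl fun a ha => topCoef_lieD hv (hβ a ha) hy,
    ← divCoord_sum (uniqueDiffWithinAt_of_mem_target hy) fun a ha =>
      differentiableWithinAt_range_of_contDiffOn (hW a ha) hy]
  simp only [topCoef_sum, Finset.sum_smul]

theorem lieD_fsmul_top {f : DForm m M 0} {v : VField m M} {β : DForm m M (m + 1)}
    (hf : IsSmooth f) (hv : IsSmoothV v) (hβ : IsSmooth β) :
    lieD v (fsmul f β) = fsmul (lieD v f) β + fsmul f (lieD v β) := by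
  refine topForm_eq_of_topCoef fun i y hy => ?_
  have hsum : topCoef (fsmul (lieD v f) β + fsmul f (lieD v β)) i y =
      topCoef (fsmul (lieD v f) β) i y + topCoef (fsmul f (lieD v β)) i y := rfl
  have hW : ContDiffOn ℝ ∞ (fun z => topCoef β i z • vInChart v i z) (φ i).target :=
    (isSmooth_top_iff.1 hβ i).smul (hv i)
  rw [hsum, topCoef_fsmul, topCoef_fsmul, fInChart_lieD_zero hf v hy, topCoef_lieD hv hβ hy,
    topCoef_lieD hv (hf.fsmul hβ) hy]
  simp only [topCoef_fsmul, mul_smul]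
  rw [divCoord_smul (X := fun z => topCoef β i z • vInChart v i z)
    (uniqueDiffWithinAt_of_mem_target hy)
    (differentiableWithinAt_range_of_contDiffOn (isSmooth_zero_iff.1 hf i) hy)
    (differentiableWithinAt_range_of_contDiffOn hW hy), map_smul, smul_eq_mul, mul_comm]

end Smoothness

section Volume

variable {i : M} {y : EuclideanSpace ℝ (Fin (m + 1))}

theorem contMDiffOn_dChartSymm [IsManifold (𝓡∂ (m + 1)) ∞ M] (i : M) (u : 𝔼) :
    ContMDiffOn 𝓘(ℝ, 𝔼) (𝓡∂ (m + 1)).tangent ∞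
      (fun y => (⟨(φ i).symm y, dChartSymm i y u⟩ : TangentBundle (𝓡∂ (m + 1)) M))
      (φ i).target := by
  have htangent := (contMDiffOn_extChartAt_symm (I := 𝓡∂ (m + 1)) (n := ∞)
    i).contMDiffOn_tangentMapWithin (m := ∞) (by simp)
    (uniqueDiffOn_extChartAt_target i).uniqueMDiffOn
  have hconst : ContMDiff 𝓘(ℝ, 𝔼) 𝓘(ℝ, 𝔼).tangent ∞
      (fun y => (⟨y, u⟩ : TangentBundle 𝓘(ℝ, 𝔼) 𝔼)) :=
    contMDiff_vectorSpace_iff_contDiff.2 contDiff_const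
  refine (htangent.comp hconst.contMDiffOn fun y hy => hy).congr fun y hy =>
    congrArg (TotalSpace.mk _) ?_
  have hrange : mfderivWithin 𝓘(ℝ, 𝔼) (𝓡∂ (m + 1)) (φ i).symm ℍ y =
      mfderivWithin 𝓘(ℝ, 𝔼) (𝓡∂ (m + 1)) (φ i).symm (φ i).target y :=
    mfderivWithin_congr_set (nhdsWithin_eq_iff_eventuallyEq.1
      (nhdsWithin_extChartAt_target_eq_of_mem hy).symm)
  exact congrArg (fun L => L u) hrange

/-- Contraction with the standard determinant form, an isomorphism from vectors to forms of
codegree one. -/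
def contractDet (m : ℕ) : EuclideanSpace ℝ (Fin (m + 1)) ≃L[ℝ]
    EuclideanSpace ℝ (Fin (m + 1)) [⋀^Fin m]→L[ℝ] ℝ :=
  have hdet : stdDet m ≠ 0 := fun h => by simpa [h] using stdDet_stdE (m := m)
  (LinearEquiv.ofBijective
    { toFun := fun v => interiorAt v (stdDet m)
      map_add' := fun v w => interiorAt_add v w _
      map_smul' := fun c v => interiorAt_smul c v _ }
    ⟨interiorAt_injective (by simp) hdet,
      interiorAt_surjective (by simp) hdet⟩).toContinuousLinearEquiv

variable [RiemannianBundle (fun x : M => TangentSpace (𝓡∂ (m + 1)) x)]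

theorem vol_ne_zero (o : ManifoldOrientation m M) (x : M) : vol o x ≠ 0 := by
  intro h
  let b : OrthonormalBasis (Fin (m + 1)) ℝ (TangentSpace (𝓡∂ (m + 1)) x) :=
    (o.orient x).finOrthonormalBasis m.succ_pos Fact.out
  have hzero : (o.orient x).volumeForm b = 0 := congrArg (fun f => f b) h
  simpa [hzero] using (o.orient x).abs_volumeForm_apply_of_orthonormal b

theorem interiorAt_hat (o : ManifoldOrientation m M) (w : DForm m M m) (x : M) :
    interiorAt (hat o w x) (vol o x) = w x :=
  Function.invFun_eq (interiorAt_surjective Fact.out (vol_ne_zero o x) (w x))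

theorem contract_hat (o : ManifoldOrientation m M) (w : DForm m M m) :
    contract (hat o w) (vol o) = w := funext fun x => interiorAt_hat o w x

theorem hat_contract (o : ManifoldOrientation m M) (v : VField m M) :
    hat o (contract v (vol o)) = v := funext fun x =>
  interiorAt_injective Fact.out (vol_ne_zero o x) (interiorAt_hat o _ x)

theorem wedge_one (h : 1 + m = m + 1) (o : ManifoldOrientation m M) (α : DForm m M 1)
    (w : DForm m M m) : wedge h α w = fsmul (contract (hat o w) α) (vol o) := by
  funext x
  conv_lhs => rw [wedge, ← interiorAt_hat o w x, wedgeAt_interiorAt h Fact.out]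
  exact congrArg (fun u => α x u • vol o x) (funext fun l => by rw [Subsingleton.elim l 0]; rfl)

theorem exists_eq_smul_vol (o : ManifoldOrientation m M) (a : DForm m M (m + 1)) (x : M) :
    ∃ c : ℝ, a x = c • vol o x := by
  let b : Basis (Fin (m + 1)) ℝ (TangentSpace (𝓡∂ (m + 1)) x) := finBasisOfFinrankEq ℝ _ Fact.out
  have hb : vol o x b ≠ 0 := fun h0 => vol_ne_zero o x (topForm_ext b (by simpa using h0))
  refine ⟨a x b / vol o x b, topForm_ext b ?_⟩
  rw [ContinuousAlternatingMap.smul_apply, smul_eq_mul, div_mul_cancel₀ _ hb]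

theorem fval_star_of_eq_smul_vol (h : 0 + (m + 1) = m + 1) (o : ManifoldOrientation m M)
    {a : DForm m M (m + 1)} {x : M} {c : ℝ} (hc : a x = c • vol o x) :
    fval (star h o a) x = c := by
  let e := stdOrthonormalBasis ℝ (TangentSpace (𝓡∂ (m + 1)) x)
  have hterm (f : Fin (m + 1) → Fin (finrank ℝ (TangentSpace (𝓡∂ (m + 1)) x))) :
      (a x (fun i => e (f i)) • contractFirst (m + 1)
        (toCont ((vol o x).toAlternatingMap.domDomCongr (finCongr h.symm)))
        (fun i => e (f i))) Fin.elim0 = c * (o.orient x).volumeForm (fun i => e (f i)) ^ 2 := by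
    rw [ContinuousAlternatingMap.smul_apply, contractFirst_zero_apply, hc, toCont_apply,
      AlternatingMap.domDomCongr_apply, ContinuousAlternatingMap.smul_apply, smul_eq_mul,
      smul_eq_mul, sq, mul_assoc]
    rfl
  have hfact : ((m + 1).factorial : ℝ) ≠ 0 := by positivity
  rw [fval, star, ContinuousAlternatingMap.smul_apply, ContinuousAlternatingMap.sum_apply,
    Finset.sum_congr rfl fun f _ => hterm f, ← Finset.mul_sum,
    sum_volumeForm_sq (o.orient x) Fact.out e, smul_eq_mul, mul_left_comm, inv_mul_cancel₀ hfact,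
    mul_one]

theorem fsmul_star_vol (h : 0 + (m + 1) = m + 1) (o : ManifoldOrientation m M)
    (a : DForm m M (m + 1)) : fsmul (star h o a) (vol o) = a := by
  funext x
  obtain ⟨c, hc⟩ := exists_eq_smul_vol o a x
  rw [hc, ← fval_star_of_eq_smul_vol h o hc]
  rfl

theorem chartSign_eq_sign_topCoef_vol (o : ManifoldOrientation m M) :
    chartSign o.orient i y = (SignType.sign (topCoef (vol o) i y) : ℝ) := rfl

theorem chartSign_mul_topCoef_fsmul_vol (o : ManifoldOrientation m M) (g : DForm m M 0) :
    chartSign o.orient i y * topCoef (fsmul g (vol o)) i y =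
      fInChart (fval g) i y * |topCoef (vol o) i y| := by
  rw [topCoef_fsmul, chartSign_eq_sign_topCoef_vol, mul_left_comm, sign_mul_self]

/-- The Gram determinant of the coordinate frame of the chart at `i`. -/
def gramDet (i : M) (y : 𝔼) : ℝ :=
  (Matrix.gram ℝ fun k => dChartSymm i y (stdE m k)).det

theorem topCoef_vol_sq (o : ManifoldOrientation m M) (i : M) (y : 𝔼) :
    topCoef (vol o) i y ^ 2 = gramDet i y :=
  volumeForm_sq (o.orient _) ((o.orient _).finOrthonormalBasis m.succ_pos Fact.out) _

theorem topCoef_vol_eq (o : ManifoldOrientation m M) (i : M) (y : 𝔼) :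
    topCoef (vol o) i y = chartSign o.orient i y * √(gramDet i y) := by
  rw [← topCoef_vol_sq o, Real.sqrt_sq_eq_abs, chartSign_eq_sign_topCoef_vol, sign_mul_abs]

variable [IsManifold (𝓡∂ (m + 1)) ∞ M]

theorem topCoef_vol_ne_zero (o : ManifoldOrientation m M) (hy : y ∈ (φ i).target) :
    topCoef (vol o) i y ≠ 0 := by
  intro h
  apply vol_ne_zero o ((φ i).symm y)
  rw [eq_inChart_comp (vol o) ((φ i).map_target hy), (φ i).right_inv hy, inChart_top_eq, h,
    zero_smul]
  rfl

theorem chartSign_eq_or (o : ManifoldOrientation m M) (hy : y ∈ (φ i).target) :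
    chartSign o.orient i y = 1 ∨ chartSign o.orient i y = -1 := by
  rw [chartSign_eq_sign_topCoef_vol]
  rcases lt_or_gt_of_ne (topCoef_vol_ne_zero o hy) with h | h
  · exact .inr (by simp [sign_neg h])
  · exact .inl (by simp [sign_pos h])

theorem eventually_chartSign_eq (o : ManifoldOrientation m M) (hy : y ∈ (φ i).target) :
    ∀ᶠ z in 𝓝[(φ i).target] y, chartSign o.orient i z = chartSign o.orient i y := by
  have hball := (o.continuousOn_sign i y hy).eventually (Metric.ball_mem_nhds _ one_pos)
  filter_upwards [hball, self_mem_nhdsWithin] with z hz hzt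
  rw [Real.dist_eq, abs_lt] at hz
  rcases chartSign_eq_or o hy with h | h <;> rcases chartSign_eq_or o hzt with h' | h' <;>
    linarith [hz.1, hz.2]

theorem contDiffOn_chartSign (o : ManifoldOrientation m M) (i : M) :
    ContDiffOn ℝ ∞ (chartSign o.orient i) (φ i).target := fun y hy =>
  (contDiffWithinAt_const (c := chartSign o.orient i y)).congr_of_eventuallyEq
    (eventually_chartSign_eq o hy) rfl

theorem inChart_contract_vol (o : ManifoldOrientation m M) (v : VField m M)
    (hy : y ∈ (φ i).target) :
    inChart (contract v (vol o)) i y =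
      topCoef (vol o) i y • contractDet m (vInChart v i y) := by
  rw [inChart_contract v _ hy, inChart_top_eq]
  rfl

variable [IsContMDiffRiemannianBundle (𝓡∂ (m + 1)) ∞ (EuclideanSpace ℝ (Fin (m + 1)))
  (fun x : M => TangentSpace (𝓡∂ (m + 1)) x)]

theorem contDiffOn_gramDet (i : M) : ContDiffOn ℝ ∞ (gramDet i) (φ i).target := by
  have hmetric (u u' : 𝔼) : ContDiffOn ℝ ∞
      (fun y => inner ℝ (dChartSymm i y u) (dChartSymm i y u')) (φ i).target :=
    contMDiffOn_iff_contDiffOn.1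
      ((contMDiffOn_dChartSymm i u).inner_bundle (contMDiffOn_dChartSymm i u'))
  unfold gramDet
  simp only [Matrix.det_apply, Matrix.gram_apply]
  exact ContDiffOn.sum fun σ _ =>
    (contDiffOn_prod fun k _ => hmetric _ _).const_smul (Equiv.Perm.sign σ)

theorem isSmooth_vol (o : ManifoldOrientation m M) : IsSmooth (vol o) := by
  refine isSmooth_top_iff.2 fun i =>
    ((contDiffOn_chartSign o i).mul ((contDiffOn_gramDet i).sqrt fun y hy => ?_)).congr
      fun y _ => topCoef_vol_eq o i y
  rw [← topCoef_vol_sq o]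
  exact pow_ne_zero 2 (topCoef_vol_ne_zero o hy)

theorem contDiffOn_topCoef_vol (o : ManifoldOrientation m M) (i : M) :
    ContDiffOn ℝ ∞ (topCoef (vol o) i) (φ i).target :=
  isSmooth_top_iff.1 (isSmooth_vol o) i

theorem isSmooth_star (h : 0 + (m + 1) = m + 1) (o : ManifoldOrientation m M)
    {a : DForm m M (m + 1)} (ha : IsSmooth a) : IsSmooth (star h o a) := by
  refine isSmooth_zero_iff.2 fun i => ((isSmooth_top_iff.1 ha i).div (contDiffOn_topCoef_vol o i)
    fun y hy => topCoef_vol_ne_zero o hy).congr fun y hy => ?_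
  rw [Pi.div_apply, eq_div_iff (topCoef_vol_ne_zero o hy), ← topCoef_fsmul, fsmul_star_vol]

theorem isSmoothV_hat (o : ManifoldOrientation m M) {w : DForm m M m} (hw : IsSmooth w) :
    IsSmoothV (hat o w) := fun i => by
  refine (((contDiffOn_topCoef_vol o i).inv fun y hy => topCoef_vol_ne_zero o hy).smul
    ((contractDet m).symm.contDiff.comp_contDiffOn (hw i))).congr fun y hy => ?_
  have h := inChart_contract_vol o (hat o w) hy
  rw [contract_hat] at h
  change _ = (topCoef (vol o) i y)⁻¹ • (contractDet m).symm (inChart w i y)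
  rw [h, map_smul, ContinuousLinearEquiv.symm_apply_apply,
    inv_smul_smul₀ (topCoef_vol_ne_zero o hy)]

end Volume

section HalfSpace

theorem mem_halfSpace_iff {y : 𝔼} : y ∈ ℍ ↔ 0 ≤ y 0 :=
  Set.ext_iff.1 (range_modelWithCornersEuclideanHalfSpace (m + 1)) y

theorem halfSpace_mem_nhds {y : 𝔼} (hy : 0 < y 0) : ℍ ∈ 𝓝 y := by
  have hcont : Continuous fun z : 𝔼 => z 0 := (EuclideanSpace.proj 0).continuous
  filter_upwards [hcont.continuousAt.eventually (lt_mem_nhds hy)] with z hz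
  exact mem_halfSpace_iff.2 hz.le

theorem bdryIncl_mem_halfSpace (y : EuclideanSpace ℝ (Fin m)) : bdryIncl m y ∈ ℍ :=
  mem_halfSpace_iff.2 le_rfl

theorem ofLp_mem_Icc_of_norm_le {n : ℕ} {R : ℝ} {y : EuclideanSpace ℝ (Fin n)} (hy : ‖y‖ ≤ R) :
    y.ofLp ∈ Icc (fun _ => -R) (fun _ => R) :=
  ⟨fun j => (abs_le.1 ((PiLp.norm_apply_le y j).trans hy)).1,
    fun j => (abs_le.1 ((PiLp.norm_apply_le y j).trans hy)).2⟩

theorem setIntegral_eq_setIntegral_Icc_toLp {n : ℕ} {s : Set (EuclideanSpace ℝ (Fin n))}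
    (hs : MeasurableSet s) {a b : Fin n → ℝ} (hab : ∀ x ∈ Icc a b, WithLp.toLp 2 x ∈ s)
    {f : EuclideanSpace ℝ (Fin n) → ℝ} (hf : ∀ y ∈ s, y.ofLp ∉ Icc a b → f y = 0) :
    ∫ y in s, f y = ∫ x in Icc a b, f (WithLp.toLp 2 x) := by
  rw [← (PiLp.volume_preserving_ofLp (Fin n)).setIntegral_preimage_emb
    (MeasurableEquiv.toLp 2 (Fin n → ℝ)).symm.measurableEmbedding]
  exact setIntegral_eq_of_subset_of_forall_sdiff_eq_zero hs (fun y hy => hab _ hy)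
    fun y hy => hf y hy.1 hy.2

variable {X : EuclideanSpace ℝ (Fin (m + 1)) → EuclideanSpace ℝ (Fin (m + 1))} {R : ℝ}
  {a b : Fin (m + 1) → ℝ}

theorem continuousOn_divCoord (hX : ContDiffOn ℝ ∞ X ℍ) : ContinuousOn (divCoord X) ℍ := by
  have hderiv : ContDiffOn ℝ ∞ (fderivWithin ℝ X ℍ) ℍ :=
    hX.fderivWithin (𝓡∂ (m + 1)).uniqueDiffOn (by simp)
  exact continuousOn_finsetSum _ fun j _ =>
    (EuclideanSpace.proj j : _ →L[ℝ] ℝ).continuous.comp_continuousOn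
      (hderiv.continuousOn.clm_apply continuousOn_const)

theorem toLp_mem_halfSpace (ha : 0 ≤ a 0) {x : Fin (m + 1) → ℝ} (hx : x ∈ Icc a b) :
    WithLp.toLp 2 x ∈ ℍ :=
  mem_halfSpace_iff.2 (ha.trans (hx.1 0))

theorem integral_divCoord_Icc (hX : ContDiffOn ℝ ∞ X ℍ) (hab : a ≤ b) (ha : 0 ≤ a 0) :
    ∫ x in Icc a b, divCoord X (WithLp.toLp 2 x) =
      ∑ j, ((∫ x in Icc (a ∘ j.succAbove) (b ∘ j.succAbove),
          X (WithLp.toLp 2 (j.insertNth (b j) x)) j) -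
        ∫ x in Icc (a ∘ j.succAbove) (b ∘ j.succAbove),
          X (WithLp.toLp 2 (j.insertNth (a j) x)) j) := by
  let L := (EuclideanSpace.equiv (Fin (m + 1)) ℝ).symm
  have hmem : MapsTo L (Icc a b) ℍ := fun x hx => toLp_mem_halfSpace ha hx
  refine integral_divergence_of_hasFDerivAt_off_countable' a b hab (fun j x => X (L x) j)
    (fun j x => (EuclideanSpace.proj j : _ →L[ℝ] ℝ) ∘L (fderivWithin ℝ X ℍ (L x)) ∘L
      (L : (Fin (m + 1) → ℝ) →L[ℝ] 𝔼)) ∅ countable_empty (fun j => ?_) (fun x hx j => ?_) ?_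
  · exact (EuclideanSpace.proj j : _ →L[ℝ] ℝ).continuous.comp_continuousOn
      (hX.continuousOn.comp L.continuous.continuousOn hmem)
  · have hx0 : ℍ ∈ 𝓝 (L x) := halfSpace_mem_nhds (ha.trans_lt (hx.1 0 (mem_univ _)).1)
    have hderiv : HasFDerivAt X (fderivWithin ℝ X ℍ (L x)) (L x) :=
      ((hX.differentiableOn (by simp)) _ (mem_of_mem_nhds hx0)).hasFDerivWithinAt.hasFDerivAt hx0
    exact (EuclideanSpace.proj j : _ →L[ℝ] ℝ).hasFDerivAt.comp x (hderiv.comp x L.hasFDerivAt)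
  · exact ((continuousOn_divCoord hX).comp L.continuous.continuousOn
      hmem).integrableOn_compact isCompact_Icc

theorem integral_face_eq_zero (ha : 0 ≤ a 0)
    (hsupp : ∀ y ∈ ℍ, R ≤ ‖y‖ → X y = 0) (j : Fin (m + 1)) {c : ℝ} (hc : c ∈ Icc (a j) (b j))
    (hcR : R ≤ |c|) :
    ∫ x in Icc (a ∘ j.succAbove) (b ∘ j.succAbove), X (WithLp.toLp 2 (j.insertNth c x)) j = 0 := by
  refine setIntegral_eq_zero_of_forall_eq_zero fun x hx => ?_
  have hmem : (j.insertNth c x : Fin (m + 1) → ℝ) ∈ Icc a b :=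
    ⟨Fin.le_insertNth_iff.2 ⟨hc.1, hx.1⟩, Fin.insertNth_le_iff.2 ⟨hc.2, hx.2⟩⟩
  have hnorm := PiLp.norm_apply_le (WithLp.toLp 2 (j.insertNth c x : Fin (m + 1) → ℝ)) j
  rw [PiLp.toLp_apply, Fin.insertNth_apply_same] at hnorm
  rw [hsupp _ (toLp_mem_halfSpace ha hmem) (hcR.trans hnorm), PiLp.zero_apply]

theorem divCoord_eq_zero_of_lt_norm (hsupp : ∀ y ∈ ℍ, R ≤ ‖y‖ → X y = 0) {y : 𝔼} (hy : y ∈ ℍ)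
    (hyR : R < ‖y‖) : divCoord X y = 0 := by
  have hzero : X =ᶠ[𝓝[ℍ] y] fun _ => 0 := by
    filter_upwards [nhdsWithin_le_nhds (continuous_norm.continuousAt.eventually
      (lt_mem_nhds hyR)), self_mem_nhdsWithin] with z hz hzℍ
    exact hsupp z hzℍ hz.le
  rw [divCoord_congr hzero hy, divCoord_zero]

theorem toLp_insertNth_zero (y : Fin m → ℝ) :
    WithLp.toLp 2 ((0 : Fin (m + 1)).insertNth (0 : ℝ) y) = bdryIncl m (WithLp.toLp 2 y) := by
  rw [Fin.insertNth_zero]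
  rfl

theorem norm_bdryIncl (y : EuclideanSpace ℝ (Fin m)) : ‖bdryIncl m y‖ = ‖y‖ := by
  rw [EuclideanSpace.norm_eq, EuclideanSpace.norm_eq, Fin.sum_univ_succ]
  simp [bdryIncl]

theorem integral_divCoord_halfSpace (hX : ContDiffOn ℝ ∞ X ℍ) (hR : 0 < R)
    (hsupp : ∀ y ∈ ℍ, R ≤ ‖y‖ → X y = 0) :
    ∫ y in ℍ, divCoord X y = -∫ y, X (bdryIncl m y) 0 := by
  let a : Fin (m + 1) → ℝ := Fin.cons 0 fun _ => -R
  let b : Fin (m + 1) → ℝ := fun _ => R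
  have hab : a ≤ b := Fin.cases hR.le fun _ => (neg_lt_self hR).le
  have hfar {y : 𝔼} (hy : y ∈ ℍ) (hyb : y.ofLp ∉ Icc a b) : R < ‖y‖ := by
    contrapose! hyb
    have hbox := ofLp_mem_Icc_of_norm_le hyb
    exact ⟨Fin.cases (mem_halfSpace_iff.1 hy) fun j => hbox.1 j.succ, hbox.2⟩
  have hinterior : ∫ y in ℍ, divCoord X y = ∫ x in Icc a b, divCoord X (WithLp.toLp 2 x) :=
    setIntegral_eq_setIntegral_Icc_toLp (𝓡∂ (m + 1)).isClosed_range.measurableSet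
      (fun _ hx => toLp_mem_halfSpace le_rfl hx)
      fun y hy hyb => divCoord_eq_zero_of_lt_norm hsupp hy (hfar hy hyb)
  have hboundary : ∫ y, X (bdryIncl m y) 0 =
      ∫ x in Icc (a ∘ Fin.succAbove 0) (b ∘ Fin.succAbove 0),
        X (WithLp.toLp 2 ((0 : Fin (m + 1)).insertNth (a 0) x)) 0 := by
    rw [← setIntegral_univ, setIntegral_eq_setIntegral_Icc_toLp .univ (fun _ _ => mem_univ _)]
    · simp only [← toLp_insertNth_zero]
      rfl
    · intro y _ hyb
      rw [hsupp _ (bdryIncl_mem_halfSpace y), PiLp.zero_apply]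
      rw [norm_bdryIncl]
      exact (not_le.1 fun h => hyb (ofLp_mem_Icc_of_norm_le h)).le
  have hfront (j : Fin (m + 1)) := integral_face_eq_zero le_rfl hsupp j
    (right_mem_Icc.2 (hab j)) (le_abs_self R)
  have hback (j : Fin m) := integral_face_eq_zero le_rfl hsupp j.succ
    (left_mem_Icc.2 (hab j.succ)) ((le_abs_self R).trans_eq (abs_neg R).symm)
  rw [hinterior, integral_divCoord_Icc hX hab le_rfl, hboundary, Fin.sum_univ_succ]
  simp only [hfront, hback, sub_zero, Finset.sum_const_zero, add_zero, zero_sub]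

end HalfSpace

section Integration

variable {i j : M} {y : EuclideanSpace ℝ (Fin (m + 1))}

theorem measurableSet_target (i : M) : MeasurableSet (φ i).target := by
  rw [extChartAt_target]
  exact ((chartAt _ i).open_target.preimage (𝓡∂ (m + 1)).continuous_symm).measurableSet.inter
    (𝓡∂ (m + 1)).isClosed_range.measurableSet

theorem measurableSet_overlap (i j : M) :
    MeasurableSet ((φ i).target ∩ (φ i).symm ⁻¹' (φ j).source) := by
  obtain ⟨U, hU, h⟩ := continuousOn_iff'.1 (continuousOn_extChartAt_symm (I := 𝓡∂ (m + 1)) i) _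
    (isOpen_extChartAt_source (I := 𝓡∂ (m + 1)) j)
  rw [inter_comm, h]
  exact hU.measurableSet.inter (measurableSet_target i)

theorem integrableOn_target {f : 𝔼 → ℝ} {K : Set 𝔼} (hK : IsCompact K) (hKt : K ⊆ (φ i).target)
    (hf : ContinuousOn f (φ i).target) (h0 : ∀ y ∈ (φ i).target \ K, f y = 0) :
    IntegrableOn f (φ i).target :=
  ((hf.mono hKt).integrableOn_compact hK).of_forall_sdiff_eq_zero (measurableSet_target i) h0

theorem contDiffOn_indicator_target {F : Type*} [NormedAddCommGroup F] [NormedSpace ℝ F]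
    {f : 𝔼 → F} {K : Set 𝔼} (hK : IsCompact K) (hKt : K ⊆ (φ i).target)
    (hf : ContDiffOn ℝ ∞ f (φ i).target) (h0 : ∀ y ∈ (φ i).target \ K, f y = 0) :
    ContDiffOn ℝ ∞ ((φ i).target.indicator f) ℍ := by
  intro y _
  by_cases hyt : y ∈ (φ i).target
  · refine (contDiffWithinAt_range_of_contDiffOn hf hyt).congr_of_eventuallyEq ?_
      (indicator_of_mem hyt f)
    filter_upwards [extChartAt_target_mem_nhdsWithin_of_mem hyt] with z hz
    exact indicator_of_mem hz f
  · have hyK : y ∉ K := fun h => hyt (hKt h)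
    refine (contDiffWithinAt_const (c := (0 : F))).congr_of_eventuallyEq ?_
      (indicator_of_notMem hyt f)
    filter_upwards [nhdsWithin_le_nhds (hK.isClosed.isOpen_compl.mem_nhds hyK)] with z hz
    by_cases hzt : z ∈ (φ i).target
    · rw [indicator_of_mem hzt, h0 z ⟨hzt, hz⟩]
    · exact indicator_of_notMem hzt f

theorem image_coordChange (i j : M) :
    coordChange i j '' ((φ i).target ∩ (φ i).symm ⁻¹' (φ j).source) =
      (φ j).target ∩ (φ j).symm ⁻¹' (φ i).source :=
  ((φ i).symm.trans (φ j)).image_source_eq_target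

theorem injOn_coordChange (i j : M) :
    InjOn (coordChange i j) ((φ i).target ∩ (φ i).symm ⁻¹' (φ j).source) :=
  ((φ i).symm.trans (φ j)).injOn

variable [RiemannianBundle (fun x : M => TangentSpace (𝓡∂ (m + 1)) x)]

/-- The integral of a top form over the domain of the chart at `i`. -/
def chartIntegral (o : ManifoldOrientation m M) (β : DForm m M (m + 1)) (i : M) : ℝ :=
  ∫ y in (φ i).target, chartSign o.orient i y * topCoef β i y

theorem chartIntegral_fsmul_vol_nonneg (o : ManifoldOrientation m M) {g : DForm m M 0}
    (hg : ∀ x, 0 ≤ fval g x) : 0 ≤ chartIntegral o (fsmul g (vol o)) i := by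
  refine setIntegral_nonneg (measurableSet_target i) fun y _ => ?_
  rw [chartSign_mul_topCoef_fsmul_vol]
  exact mul_nonneg (hg _) (abs_nonneg _)

theorem chartIntegral_eq_setIntegral_overlap (o : ManifoldOrientation m M) {β : DForm m M (m + 1)}
    (i j : M) (h0 : ∀ x ∉ (φ j).source, β x = 0) :
    chartIntegral o β i =
      ∫ y in (φ i).target ∩ (φ i).symm ⁻¹' (φ j).source,
        chartSign o.orient i y * topCoef β i y := by
  refine setIntegral_eq_of_subset_of_forall_sdiff_eq_zero (measurableSet_target i)
    inter_subset_left ?_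
  rintro y ⟨hy, hyj⟩
  rw [topCoef_eq_zero (h0 _ fun hj => hyj ⟨hy, hj⟩), mul_zero]

variable [IsManifold (𝓡∂ (m + 1)) ∞ M]

theorem chartIntegral_eq_chartIntegral (o : ManifoldOrientation m M) (β : DForm m M (m + 1))
    (i j : M) (hi : ∀ x ∉ (φ i).source, β x = 0) (hj : ∀ x ∉ (φ j).source, β x = 0) :
    chartIntegral o β i = chartIntegral o β j := by
  have hderiv (y : 𝔼) (hy : y ∈ (φ i).target ∩ (φ i).symm ⁻¹' (φ j).source) :
      HasFDerivWithinAt (coordChange i j) (fderivWithin ℝ (coordChange i j) ℍ y)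
        ((φ i).target ∩ (φ i).symm ⁻¹' (φ j).source) y :=
    ((contDiffWithinAt_coordChange hy.1 hy.2).differentiableWithinAt
      (by simp)).hasFDerivWithinAt.mono fun z hz => mem_range_of_mem_target hz.1
  rw [chartIntegral_eq_setIntegral_overlap o i j hj,
    chartIntegral_eq_setIntegral_overlap o j i hi, ← image_coordChange i j,
    integral_image_eq_integral_abs_det_fderiv_smul volume
      (measurableSet_overlap i j) hderiv (injOn_coordChange i j)]
  refine setIntegral_congr_fun (measurableSet_overlap i j) fun y hy => ?_
  simp only [chartSign_eq_sign_topCoef_vol, topCoef_coordChange _ hy.1 hy.2, sign_mul, smul_eq_mul]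
  rw [← sign_mul_self, SignType.coe_mul]
  ring

end Integration

section ChartStokes

variable {i : M} {y : EuclideanSpace ℝ (Fin (m + 1))}

theorem isCompact_image_extChartAt {K : Set M} (hK : IsCompact K) (hKi : K ⊆ (φ i).source) :
    IsCompact (φ i '' K) :=
  hK.image_of_continuousOn ((continuousOn_extChartAt i).mono hKi)

theorem image_extChartAt_subset_target {K : Set M} (hKi : K ⊆ (φ i).source) :
    φ i '' K ⊆ (φ i).target :=
  image_subset_iff.2 fun _ hx => (φ i).map_source (hKi hx)

theorem symm_notMem_of_notMem_image {K : Set M} (hy : y ∈ (φ i).target \ φ i '' K) :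
    (φ i).symm y ∉ K := fun h =>
  hy.2 ⟨_, h, (φ i).right_inv hy.1⟩

theorem measurableSet_bdryIncl_mem_target (i : M) :
    MeasurableSet {y : EuclideanSpace ℝ (Fin m) | bdryIncl m y ∈ (φ i).target} :=
  (bdryIncl m).continuous.measurable (measurableSet_target i)

theorem integral_divCoord_target {W : 𝔼 → 𝔼} {K : Set 𝔼} (hK : IsCompact K)
    (hKt : K ⊆ (φ i).target) (hW : ContDiffOn ℝ ∞ W (φ i).target)
    (h0 : ∀ y ∈ (φ i).target \ K, W y = 0) :
    ∫ y in (φ i).target, divCoord W y =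
      -∫ y in {y | bdryIncl m y ∈ (φ i).target}, W (bdryIncl m y) 0 := by
  have hoff (y : 𝔼) (hy : y ∉ K) : (φ i).target.indicator W y = 0 :=
    (em (y ∈ (φ i).target)).elim (fun hyt => (indicator_of_mem hyt W).trans (h0 y ⟨hyt, hy⟩))
      fun hyt => indicator_of_notMem hyt W
  have hout : ∀ y ∈ ℍ \ (φ i).target, divCoord ((φ i).target.indicator W) y = 0 := by
    rintro y ⟨hyr, hyt⟩
    have hyK : Kᶜ ∈ 𝓝 y := hK.isClosed.isOpen_compl.mem_nhds fun h => hyt (hKt h)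
    rw [divCoord_congr (mem_of_superset (nhdsWithin_le_nhds hyK) hoff) hyr, divCoord_zero]
  have hin : EqOn (divCoord ((φ i).target.indicator W)) (divCoord W) (φ i).target := fun y hy =>
    divCoord_congr (mem_of_superset (extChartAt_target_mem_nhdsWithin_of_mem hy)
      fun z hz => indicator_of_mem hz W) (mem_range_of_mem_target hy)
  obtain ⟨R, hR, hRK⟩ := hK.isBounded.subset_ball_lt 0 0
  have hdiv := integral_divCoord_halfSpace (contDiffOn_indicator_target hK hKt hW h0) hR
    fun y _ hy => hoff y fun hyK => (mem_ball_zero_iff.1 (hRK hyK)).not_ge hy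
  rw [setIntegral_eq_of_subset_of_forall_sdiff_eq_zero
    (𝓡∂ (m + 1)).isClosed_range.measurableSet (extChartAt_target_subset_range i) hout,
    setIntegral_congr_fun (measurableSet_target i) hin] at hdiv
  rw [hdiv, ← integral_indicator (measurableSet_bdryIncl_mem_target i)]
  classical
  exact congrArg _ (integral_congr_ae (.of_forall fun y =>
    apply_ite (fun u : 𝔼 => u 0) (bdryIncl m y ∈ (φ i).target) _ _))

theorem lieD_eq_zero_of_eventuallyEq {k : ℕ} (v : VField m M) {β : DForm m M k} {x : M}
    (h : ∀ᶠ z in 𝓝 x, β z = 0) : lieD v β x = 0 := by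
  have hx := mem_extChartAt_target (I := 𝓡∂ (m + 1)) x
  have hcont : ContinuousWithinAt (φ x).symm ℍ (φ x x) :=
    (continuousOn_extChartAt_symm x _ hx).mono_of_mem_nhdsWithin
      (extChartAt_target_mem_nhdsWithin x)
  have hev : inChart β x =ᶠ[𝓝[ℍ] (φ x x)] fun _ => 0 := by
    filter_upwards [hcont.eventually (by rwa [extChartAt_to_inv])] with z hz
    rw [inChart, hz]
    rfl
  ext u
  rw [lieD, hev.fderivWithin_eq_of_mem (mem_range_of_mem_target hx),
    hev.eq_of_nhdsWithin (mem_range_of_mem_target hx)]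
  simp [derivAct_apply]

theorem cons_bdryIncl (u : 𝔼) :
    (Fin.cons u fun j => bdryIncl m (EuclideanSpace.single j 1) : Fin (m + 1) → 𝔼) =
      Function.update (stdE m) 0 u := by
  funext l
  refine Fin.cases (by simp) (fun j => ?_) l
  rw [Fin.cons_succ, Function.update_of_ne (Fin.succ_ne_zero j)]
  ext l
  refine Fin.cases ?_ (fun l => ?_) l <;> simp [bdryIncl, stdE]

theorem apply_cons_bdryIncl (b : 𝔼 [⋀^Fin (m + 1)]→L[ℝ] ℝ) (u : 𝔼) :
    b (Fin.cons u fun j => bdryIncl m (EuclideanSpace.single j 1)) = u 0 * b (stdE m) := by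
  have h := apply_update_basis (EuclideanSpace.basisFun (Fin (m + 1)) ℝ).toBasis b 0 u
  rwa [coe_basisFun_toBasis, ← cons_bdryIncl] at h

theorem traceInChart_contract [IsManifold (𝓡∂ (m + 1)) ∞ M] (v : VField m M)
    (β : DForm m M (m + 1)) {y : EuclideanSpace ℝ (Fin m)} (hy : bdryIncl m y ∈ (φ i).target) :
    traceInChart (contract v β) i y (fun j => EuclideanSpace.single j 1) =
      topCoef β i (bdryIncl m y) * vInChart v i (bdryIncl m y) 0 := by
  rw [traceInChart, inChart_contract v β hy, mul_comm]
  exact apply_cons_bdryIncl (inChart β i (bdryIncl m y)) _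

variable [RiemannianBundle (fun x : M => TangentSpace (𝓡∂ (m + 1)) x)]

theorem bdrySign_eq (o : ManifoldOrientation m M) (y : EuclideanSpace ℝ (Fin m)) :
    bdrySign o i y = -chartSign o.orient i (bdryIncl m y) := by
  rw [bdrySign, apply_cons_bdryIncl, chartSign_eq_sign_topCoef_vol]
  simp [topCoef, Left.sign_neg]

/-- The integral of the trace of an `m`-form over the part of the boundary of `M` that lies in the
domain of the chart at `i`. -/
def chartBdryIntegral (o : ManifoldOrientation m M) (η : DForm m M m) (i : M) : ℝ :=
  ∫ y in {y | bdryIncl m y ∈ (φ i).target},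
    bdrySign o i y * traceInChart η i y (fun j => EuclideanSpace.single j 1)

variable [IsManifold (𝓡∂ (m + 1)) ∞ M]

theorem divCoord_chartSign_smul (o : ManifoldOrientation m M) {X : 𝔼 → 𝔼}
    (hX : ContDiffOn ℝ ∞ X (φ i).target) (hy : y ∈ (φ i).target) :
    divCoord (fun z => chartSign o.orient i z • X z) y =
      chartSign o.orient i y * divCoord X y := by
  have hsign : fderivWithin ℝ (chartSign o.orient i) ℍ y = 0 := by
    have hconst := eventually_chartSign_eq o hy
    rw [nhdsWithin_extChartAt_target_eq_of_mem hy] at hconst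
    exact (EventuallyEq.fderivWithin_eq_of_mem hconst (mem_range_of_mem_target hy)).trans
      (fderivWithin_const_apply _)
  rw [divCoord_smul (uniqueDiffWithinAt_of_mem_target hy)
    (differentiableWithinAt_range_of_contDiffOn (contDiffOn_chartSign o i) hy)
    (differentiableWithinAt_range_of_contDiffOn hX hy), hsign]
  simp

theorem chartIntegral_lieD (o : ManifoldOrientation m M) {v : VField m M}
    {β : DForm m M (m + 1)} (hv : IsSmoothV v) (hβ : IsSmooth β) {K : Set M} (hK : IsCompact K)
    (hKi : K ⊆ (φ i).source) (h0 : ∀ x ∉ K, β x = 0) :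
    chartIntegral o (lieD v β) i = chartBdryIntegral o (contract v β) i := by
  have hX : ContDiffOn ℝ ∞ (fun z => topCoef β i z • vInChart v i z) (φ i).target :=
    (isSmooth_top_iff.1 hβ i).smul (hv i)
  have hdiv := integral_divCoord_target (isCompact_image_extChartAt hK hKi)
    (image_extChartAt_subset_target hKi) ((contDiffOn_chartSign o i).smul hX) fun y hy => by
      simp only [Pi.smul_apply', topCoef_eq_zero (h0 _ (symm_notMem_of_notMem_image hy)),
        zero_smul, smul_zero]
  calc chartIntegral o (lieD v β) i
      = ∫ y in (φ i).target, divCoord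
          (fun z => chartSign o.orient i z • (topCoef β i z • vInChart v i z)) y :=
        setIntegral_congr_fun (measurableSet_target i) fun y hy => by
          simp only [topCoef_lieD hv hβ hy, divCoord_chartSign_smul o hX hy]
    _ = -∫ y in {y | bdryIncl m y ∈ (φ i).target}, chartSign o.orient i (bdryIncl m y) *
          (topCoef β i (bdryIncl m y) * vInChart v i (bdryIncl m y) 0) := hdiv
    _ = chartBdryIntegral o (contract v β) i := by
        rw [← integral_neg]
        refine setIntegral_congr_fun (measurableSet_bdryIncl_mem_target i) fun y hy => ?_
        simp only [traceInChart_contract v β hy, bdrySign_eq, neg_mul]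

end ChartStokes

section Stokes

variable {i : M}

/-- A function as a `0`-form. -/
def ofFun (f : M → ℝ) : DForm m M 0 := fun x =>
  ContinuousAlternatingMap.constOfIsEmpty ℝ (TangentSpace (𝓡∂ (m + 1)) x) (Fin 0) (f x)

theorem fsmul_ofFun {k : ℕ} (f : M → ℝ) (β : DForm m M k) (x : M) :
    fsmul (ofFun f) β x = f x • β x := rfl

theorem fsmul_sum {k : ℕ} {ι : Type*} (f : DForm m M 0) (s : Finset ι) (β : ι → DForm m M k) :
    fsmul f (∑ a ∈ s, β a) = ∑ a ∈ s, fsmul f (β a) := by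
  funext x
  simp only [fsmul, Finset.sum_apply, Finset.smul_sum]

variable [IsManifold (𝓡∂ (m + 1)) ∞ M]

theorem isSmooth_ofFun {f : M → ℝ} (hf : ContMDiff (𝓡∂ (m + 1)) 𝓘(ℝ, ℝ) ∞ f) :
    IsSmooth (ofFun f : DForm m M 0) :=
  isSmooth_zero_iff.2 fun i =>
    contMDiffOn_iff_contDiffOn.1 (hf.comp_contMDiffOn (contMDiffOn_extChartAt_symm i))

section PartitionOfUnity

variable [CompactSpace M] [T2Space M]

theorem tsupport_chartPOU_subset (i : M) : tsupport (chartPOU m M i) ⊆ (φ i).source := by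
  rw [extChartAt_source]
  exact Classical.choose_spec
    (SmoothPartitionOfUnity.exists_isSubordinate_chartAt_source (𝓡∂ (m + 1)) M) i

theorem isSmooth_chartPOU (i : M) : IsSmooth (ofFun (chartPOU m M i) : DForm m M 0) :=
  isSmooth_ofFun (chartPOU m M i).contMDiff

theorem finite_chartPOU (m : ℕ) (M : Type*) [TopologicalSpace M]
    [ChartedSpace (EuclideanHalfSpace (m + 1)) M] [IsManifold (𝓡∂ (m + 1)) ∞ M] [CompactSpace M]
    [T2Space M] : {i : M | (Function.support (chartPOU m M i)).Nonempty}.Finite :=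
  (chartPOU m M).locallyFinite.finite_nonempty_of_compact

/-- The indices of the nonzero functions of the partition of unity. -/
def chartIdx (m : ℕ) (M : Type*) [TopologicalSpace M]
    [ChartedSpace (EuclideanHalfSpace (m + 1)) M] [IsManifold (𝓡∂ (m + 1)) ∞ M] [CompactSpace M]
    [T2Space M] : Finset M :=
  (finite_chartPOU m M).toFinset

theorem chartPOU_eq_zero (hi : i ∉ chartIdx m M) (x : M) : chartPOU m M i x = 0 :=
  of_not_not fun h => hi ((finite_chartPOU m M).mem_toFinset.2 ⟨x, h⟩)

theorem sum_chartPOU (x : M) : ∑ i ∈ chartIdx m M, chartPOU m M i x = 1 := by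
  rw [← (chartPOU m M).sum_eq_one (mem_univ x)]
  exact (finsum_eq_sum_of_support_subset _ fun i hi =>
    of_not_not fun h => hi (chartPOU_eq_zero h x)).symm

theorem sum_fsmul_chartPOU {k : ℕ} (β : DForm m M k) :
    ∑ i ∈ chartIdx m M, fsmul (ofFun (chartPOU m M i)) β = β := by
  funext x
  simp only [Finset.sum_apply, fsmul_ofFun, ← Finset.sum_smul, sum_chartPOU, one_smul]

theorem fsmul_chartPOU_eq_zero {k : ℕ} (β : DForm m M k) {x : M}
    (hx : x ∉ tsupport (chartPOU m M i)) : fsmul (ofFun (chartPOU m M i)) β x = 0 := by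
  rw [fsmul_ofFun, image_eq_zero_of_notMem_tsupport hx, zero_smul]

variable [RiemannianBundle (fun x : M => TangentSpace (𝓡∂ (m + 1)) x)]

theorem integralM_eq_sum (o : ManifoldOrientation m M) (β : DForm m M (m + 1)) :
    integralM o β = ∑ i ∈ chartIdx m M, chartIntegral o (fsmul (ofFun (chartPOU m M i)) β) i := by
  rw [integralM, finsum_eq_sum_of_support_subset (s := chartIdx m M)]
  · refine Finset.sum_congr rfl fun i _ => integral_congr_ae (.of_forall fun y => ?_)
    exact mul_assoc _ _ _
  · refine fun i hi => of_not_not fun h => hi ?_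
    simp only [chartPOU_eq_zero h, mul_zero, zero_mul, integral_zero]

theorem integralBdry_eq_sum (o : ManifoldOrientation m M) (η : DForm m M m) :
    integralBdry o η =
      ∑ i ∈ chartIdx m M, chartBdryIntegral o (fsmul (ofFun (chartPOU m M i)) η) i := by
  rw [integralBdry, finsum_eq_sum_of_support_subset (s := chartIdx m M)]
  · refine Finset.sum_congr rfl fun i _ => integral_congr_ae (.of_forall fun y => ?_)
    exact mul_assoc _ _ _
  · refine fun i hi => of_not_not fun h => hi ?_
    simp only [chartPOU_eq_zero h, mul_zero, zero_mul, integral_zero]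

theorem integralM_neg (o : ManifoldOrientation m M) (β : DForm m M (m + 1)) :
    integralM o (-β) = -integralM o β := by
  rw [integralM, integralM, ← finsum_neg_distrib]
  refine finsum_congr fun i => ?_
  rw [← integral_neg]
  exact integral_congr_ae (.of_forall fun y => mul_neg _ _)

theorem integralBdry_neg (o : ManifoldOrientation m M) (η : DForm m M m) :
    integralBdry o (-η) = -integralBdry o η := by
  rw [integralBdry, integralBdry, ← finsum_neg_distrib]
  refine finsum_congr fun i => ?_
  rw [← integral_neg]
  exact integral_congr_ae (.of_forall fun y => mul_neg _ _)

end PartitionOfUnity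

variable [RiemannianBundle (fun x : M => TangentSpace (𝓡∂ (m + 1)) x)]

theorem chartIntegral_sum {ι : Type*} (o : ManifoldOrientation m M) {s : Finset ι}
    {β : ι → DForm m M (m + 1)} (hβ : ∀ a ∈ s, IsSmooth (β a)) {K : Set M} (hK : IsCompact K)
    (hKi : K ⊆ (φ i).source) (h0 : ∀ a ∈ s, ∀ x ∉ K, β a x = 0) :
    chartIntegral o (∑ a ∈ s, β a) i = ∑ a ∈ s, chartIntegral o (β a) i := by
  unfold chartIntegral
  rw [← integral_finsetSum]
  · simp only [topCoef_sum, Finset.mul_sum]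
  · refine fun a ha => integrableOn_target (isCompact_image_extChartAt hK hKi)
      (image_extChartAt_subset_target hKi)
      ((contDiffOn_chartSign o i).mul (isSmooth_top_iff.1 (hβ a ha) i)).continuousOn fun y hy => ?_
    rw [topCoef_eq_zero (h0 a ha _ (symm_notMem_of_notMem_image hy)), mul_zero]

variable [CompactSpace M] [T2Space M]

theorem integralM_sum {ι : Type*} (o : ManifoldOrientation m M) {s : Finset ι}
    {β : ι → DForm m M (m + 1)} (hβ : ∀ a ∈ s, IsSmooth (β a)) :
    integralM o (∑ a ∈ s, β a) = ∑ a ∈ s, integralM o (β a) := by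
  simp only [integralM_eq_sum, fsmul_sum]
  rw [Finset.sum_comm]
  exact Finset.sum_congr rfl fun i _ =>
    chartIntegral_sum o (fun a ha => (isSmooth_chartPOU i).fsmul (hβ a ha))
      (isClosed_tsupport _).isCompact (tsupport_chartPOU_subset i)
      fun a _ _ hx => fsmul_chartPOU_eq_zero (β a) hx

theorem integralM_add (o : ManifoldOrientation m M) {β γ : DForm m M (m + 1)} (hβ : IsSmooth β)
    (hγ : IsSmooth γ) : integralM o (β + γ) = integralM o β + integralM o γ := by
  have hβγ : ∀ a : Fin 2, IsSmooth (![β, γ] a) := Fin.forall_fin_two.2 ⟨hβ, hγ⟩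
  simpa only [Fin.sum_univ_two, Matrix.cons_val_zero, Matrix.cons_val_one] using
    integralM_sum o (s := Finset.univ) fun a _ => hβγ a

theorem integralM_eq_chartIntegral (o : ManifoldOrientation m M) {β : DForm m M (m + 1)}
    (hβ : IsSmooth β) {K : Set M} (hK : IsCompact K) (hKi : K ⊆ (φ i).source)
    (h0 : ∀ x ∉ K, β x = 0) : integralM o β = chartIntegral o β i := by
  have hρβ (j x : M) (hx : β x = 0) : fsmul (ofFun (chartPOU m M j)) β x = 0 := by
    rw [fsmul_ofFun, hx, smul_zero]
  calc integralM o β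
      = ∑ j ∈ chartIdx m M, chartIntegral o (fsmul (ofFun (chartPOU m M j)) β) j :=
        integralM_eq_sum o β
    _ = ∑ j ∈ chartIdx m M, chartIntegral o (fsmul (ofFun (chartPOU m M j)) β) i :=
        Finset.sum_congr rfl fun j _ => chartIntegral_eq_chartIntegral o _ j i
          (fun x hx => fsmul_chartPOU_eq_zero β fun h => hx (tsupport_chartPOU_subset j h))
          fun x hx => hρβ j x (h0 x fun h => hx (hKi h))
    _ = chartIntegral o (∑ j ∈ chartIdx m M, fsmul (ofFun (chartPOU m M j)) β) i :=
        (chartIntegral_sum o (fun j _ => (isSmooth_chartPOU j).fsmul hβ) hK hKi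
          fun j _ x hx => hρβ j x (h0 x hx)).symm
    _ = chartIntegral o β i := by rw [sum_fsmul_chartPOU]

theorem integralM_lieD_fsmul_chartPOU (o : ManifoldOrientation m M) {v : VField m M}
    {β : DForm m M (m + 1)} (hv : IsSmoothV v) (hβ : IsSmooth β) (i : M) :
    integralM o (lieD v (fsmul (ofFun (chartPOU m M i)) β)) =
      chartBdryIntegral o (contract v (fsmul (ofFun (chartPOU m M i)) β)) i := by
  have hρβ : IsSmooth (fsmul (ofFun (chartPOU m M i)) β) := (isSmooth_chartPOU i).fsmul hβ
  have hK : IsCompact (tsupport (chartPOU m M i)) := (isClosed_tsupport _).isCompact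
  rw [← chartIntegral_lieD o hv hρβ hK (tsupport_chartPOU_subset i) fun x hx =>
    fsmul_chartPOU_eq_zero β hx]
  refine integralM_eq_chartIntegral o (hρβ.lieD_top hv) hK (tsupport_chartPOU_subset i)
    fun x hx => lieD_eq_zero_of_eventuallyEq v ?_
  filter_upwards [(isClosed_tsupport _).isOpen_compl.mem_nhds hx] with z hz
  exact fsmul_chartPOU_eq_zero β hz

-- Since `L_v β = d (ι_v β)` for a top form `β`, this is the theorem of Stokes for `ι_v β`.
theorem integralM_lieD (o : ManifoldOrientation m M) {v : VField m M} {β : DForm m M (m + 1)}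
    (hv : IsSmoothV v) (hβ : IsSmooth β) :
    integralM o (lieD v β) = integralBdry o (contract v β) := by
  have hρβ (i : M) : IsSmooth (fsmul (ofFun (chartPOU m M i)) β) := (isSmooth_chartPOU i).fsmul hβ
  calc integralM o (lieD v β)
      = integralM o (∑ i ∈ chartIdx m M, lieD v (fsmul (ofFun (chartPOU m M i)) β)) := by
        rw [← lieD_sum_top hv fun i _ => hρβ i, sum_fsmul_chartPOU]
    _ = ∑ i ∈ chartIdx m M, integralM o (lieD v (fsmul (ofFun (chartPOU m M i)) β)) :=
        integralM_sum o fun i _ => (hρβ i).lieD_top hv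
    _ = ∑ i ∈ chartIdx m M,
          chartBdryIntegral o (contract v (fsmul (ofFun (chartPOU m M i)) β)) i :=
        Finset.sum_congr rfl fun i _ => integralM_lieD_fsmul_chartPOU o hv hβ i
    _ = integralBdry o (contract v β) := by simp only [integralBdry_eq_sum, contract_fsmul]

end Stokes

section Uniqueness

variable {i c : M} {y : EuclideanSpace ℝ (Fin (m + 1))}

theorem IsSmooth.sub {k : ℕ} {α β : DForm m M k} (hα : IsSmooth α) (hβ : IsSmooth β) :
    IsSmooth (α - β) := fun i => (hα i).sub (hβ i)

theorem mem_interior_target_iff (hy : y ∈ (φ i).target) :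
    y ∈ interior (φ i).target ↔ y ∈ interior ℍ := by
  refine ⟨fun h => interior_mono (extChartAt_target_subset_range i) h, fun h => ?_⟩
  rw [mem_interior_iff_mem_nhds] at h ⊢
  rw [← nhdsWithin_eq_nhds.2 h]
  exact extChartAt_target_mem_nhdsWithin_of_mem hy

/-- The vector field with constant components `u` in the chart at `c`. -/
def coordField (c : M) (u : 𝔼) : VField m M := fun x => (dChart c x).inverse u

/-- The vector field `χ γ(e) e`, designed so that `γ` takes the nonnegative value `χ γ(e) ^ 2` on
it when `0 ≤ χ`. -/
def testField (χ : M → ℝ) (γ : DForm m M 1) (e : VField m M) : VField m M :=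
  fun x => (χ x * fval (contract e γ) x) • e x

theorem testField_eq_zero {χ : M → ℝ} (γ : DForm m M 1) (e : VField m M) {x : M}
    (hx : χ x = 0) : testField χ γ e x = 0 := by
  rw [testField, hx, zero_mul, zero_smul]

theorem fval_contract_testField (χ : M → ℝ) (γ : DForm m M 1) (e : VField m M) (x : M) :
    fval (contract (testField χ γ e) γ) x = χ x * fval (contract e γ) x ^ 2 := by
  have h : contract (testField χ γ e) γ x =
      (χ x * fval (contract e γ) x) • contract e γ x := interiorAt_smul _ _ _
  rw [sq, ← mul_assoc]
  exact congrArg (fun ξ => ξ Fin.elim0) h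

variable [IsManifold (𝓡∂ (m + 1)) ∞ M]

theorem symm_mem_interior_iff (hy : y ∈ (φ i).target) :
    (φ i).symm y ∈ (𝓡∂ (m + 1)).interior M ↔ y ∈ interior ℍ := by
  have hx : (φ i).symm y ∈ (chartAt (EuclideanHalfSpace (m + 1)) i).source := by
    rw [← extChartAt_source (𝓡∂ (m + 1))]
    exact (φ i).map_target hy
  have h := (𝓡∂ (m + 1)).isInteriorPoint_iff_of_mem_atlas (n := ∞) (by simp)
    (chart_mem_atlas (EuclideanHalfSpace (m + 1)) i) hx
  rw [← mem_interior_target_iff hy]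
  exact h.trans (iff_of_eq (congrArg (· ∈ interior (φ i).target) ((φ i).right_inv hy)))

theorem symm_bdryIncl_mem_boundary {z : EuclideanSpace ℝ (Fin m)}
    (hz : bdryIncl m z ∈ (φ i).target) :
    (φ i).symm (bdryIncl m z) ∈ (𝓡∂ (m + 1)).boundary M := by
  rw [← ModelWithCorners.compl_interior, mem_compl_iff, symm_mem_interior_iff hz,
    interior_range_modelWithCornersEuclideanHalfSpace]
  exact lt_irrefl (0 : ℝ)

theorem eq_zero_of_forall_mem_interior {k : ℕ} {γ : DForm m M k} (hγ : IsSmooth γ)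
    (h : ∀ x ∈ (𝓡∂ (m + 1)).interior M, γ x = 0) : γ = 0 := by
  funext x
  have hy : φ x x ∈ (φ x).target := mem_extChartAt_target x
  have hne : (𝓝[interior ℍ] (φ x x)).NeBot := mem_closure_iff_nhdsWithin_neBot.1
    ((𝓡∂ (m + 1)).range_subset_closure_interior (mem_range_of_mem_target hy))
  have hle : 𝓝[interior ℍ] (φ x x) ≤ 𝓝[ℍ] (φ x x) := nhdsWithin_mono _ interior_subset
  have hlim : Tendsto (inChart γ x) (𝓝[interior ℍ] (φ x x)) (𝓝 (inChart γ x (φ x x))) :=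
    (contDiffWithinAt_range_of_contDiffOn (hγ x) hy).continuousWithinAt.tendsto.mono_left hle
  have hzero : inChart γ x =ᶠ[𝓝[interior ℍ] (φ x x)] fun _ => 0 := by
    filter_upwards [hle (extChartAt_target_mem_nhdsWithin_of_mem hy), self_mem_nhdsWithin]
      with z hz hzi
    rw [inChart, h _ ((symm_mem_interior_iff hz).2 hzi)]
    rfl
  rw [eq_inChart_comp γ (mem_extChartAt_source x),
    tendsto_nhds_unique hlim (tendsto_const_nhds.congr' hzero.symm)]
  rfl

theorem contDiffWithinAt_vInChart_of_mem_source {v : VField m M}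
    (hv : ContDiffOn ℝ ∞ (vInChart v c) (φ c).target) (hy : y ∈ (φ i).target)
    (hc : (φ i).symm y ∈ (φ c).source) : ContDiffWithinAt ℝ ∞ (vInChart v i) ℍ y := by
  have htarget {z : 𝔼} (hz : (φ i).symm z ∈ (φ c).source) : coordChange i c z ∈ (φ c).target :=
    (φ c).map_source hz
  have hsource {z : 𝔼} (hzi : z ∈ (φ i).target) (hz : (φ i).symm z ∈ (φ c).source) :
      (φ c).symm (coordChange i c z) ∈ (φ i).source :=
    ((φ c).left_inv hz).symm ▸ (φ i).map_target hzi
  have hback {z : 𝔼} (hzi : z ∈ (φ i).target) (hz : (φ i).symm z ∈ (φ c).source) :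
      coordChange c i (coordChange i c z) = z :=
    (congrArg (φ i) ((φ c).left_inv hz)).trans ((φ i).right_inv hzi)
  have hderiv : ContDiffWithinAt ℝ ∞ (fderivWithin ℝ (coordChange c i) ℍ) ℍ (coordChange i c y) :=
    (contDiffWithinAt_coordChange (htarget hc) (hsource hy hc)).fderivWithin_right
      (𝓡∂ (m + 1)).uniqueDiffOn (by simp) (mem_range_of_mem_target (htarget hc))
  have hcomp := (hderiv.clm_apply (contDiffWithinAt_range_of_contDiffOn hv (htarget hc))).comp y
    (contDiffWithinAt_coordChange hy hc) (mapsTo_coordChange i c _)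
  refine hcomp.congr_of_eventuallyEq_of_mem ?_ (mem_range_of_mem_target hy)
  filter_upwards [eventually_mem_overlap hy hc] with z ⟨hzi, hz⟩
  have h := vInChart_coordChange v (htarget hz) (hsource hzi hz)
  rwa [hback hzi hz] at h

theorem isSmoothV_of_chart {v : VField m M} {K : Set M} (hK : IsClosed K)
    (hKc : K ⊆ (φ c).source) (h0 : ∀ x ∉ K, v x = 0)
    (hv : ContDiffOn ℝ ∞ (vInChart v c) (φ c).target) : IsSmoothV v := by
  intro i y hy
  refine ContDiffWithinAt.mono ?_ (extChartAt_target_subset_range i)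
  by_cases hyc : (φ i).symm y ∈ (φ c).source
  · exact contDiffWithinAt_vInChart_of_mem_source hv hy hyc
  · have hcont : ContinuousWithinAt (φ i).symm ℍ y :=
      ((continuousOn_extChartAt_symm i) y hy).mono_of_mem_nhdsWithin
        (extChartAt_target_mem_nhdsWithin_of_mem hy)
    refine (contDiffWithinAt_const (c := 0)).congr_of_eventuallyEq_of_mem ?_
      (mem_range_of_mem_target hy)
    filter_upwards [hcont (hK.isOpen_compl.mem_nhds fun h => hyc (hKc h))] with z hz
    rw [vInChart, h0 _ hz, map_zero]

theorem dChart_coordField (u : 𝔼) {x : M} (hx : x ∈ (φ c).source) :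
    dChart c x (coordField c u x) = u :=
  have hinv : (dChart c x).IsInvertible := isInvertible_mfderiv_extChartAt hx
  hinv.self_apply_inverse u

theorem fval_contract_coordField (γ : DForm m M 1) (u : 𝔼) {x : M} (hx : x ∈ (φ c).source) :
    fval (contract (coordField c u) γ) x = inChart γ c (φ c x) (fun _ => u) := by
  have hγ := congrArg (fun ξ => interiorAt (coordField c u x) ξ Fin.elim0) (eq_inChart_comp γ hx)
  refine hγ.trans (congrArg (inChart γ c (φ c x)) (funext fun l => ?_))
  rw [Subsingleton.elim l 0]
  exact dChart_coordField u hx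

theorem isSmoothV_testField {χ : M → ℝ} (hχ : IsSmooth (ofFun χ : DForm m M 0))
    (hχc : tsupport χ ⊆ (φ c).source) {γ : DForm m M 1} (hγ : IsSmooth γ) (u : 𝔼) :
    IsSmoothV (testField χ γ (coordField c u)) := by
  refine isSmoothV_of_chart (isClosed_tsupport χ) hχc
    (fun x hx => testField_eq_zero γ _ (image_eq_zero_of_notMem_tsupport hx)) ?_
  refine (((isSmooth_zero_iff.1 hχ c).mul (contDiffOn_apply (hγ c) fun _ => u)).smul
    (contDiffOn_const (c := u))).congr fun y hy => ?_
  have hx := (φ c).map_target hy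
  rw [vInChart, testField, map_smul, dChart_coordField u hx, fval_contract_coordField γ u hx,
    (φ c).right_inv hy]
  rfl

variable [RiemannianBundle (fun x : M => TangentSpace (𝓡∂ (m + 1)) x)]

theorem integralBdry_eq_zero [CompactSpace M] [T2Space M] (o : ManifoldOrientation m M)
    {η : DForm m M m} (h : ∀ x ∈ (𝓡∂ (m + 1)).boundary M, η x = 0) : integralBdry o η = 0 := by
  refine finsum_eq_zero_of_forall_eq_zero fun i =>
    setIntegral_eq_zero_of_forall_eq_zero fun y hy => ?_
  rw [traceInChart, inChart, h _ (symm_bdryIncl_mem_boundary hy)]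
  exact mul_zero _

theorem HasSurfaceTerm.isFormalDual [CompactSpace M] [T2Space M] {k l : ℕ} {h : k + l = m + 1}
    {o : ManifoldOrientation m M} {F : DForm m M m → DForm m M l}
    {ψ : DForm m M k → DForm m M 1} {η : DForm m M m → DForm m M k → DForm m M m}
    (hsurf : HasSurfaceTerm h o F ψ η)
    (hψ : ∀ abar : DForm m M k, IsSmooth abar → IsSmooth (ψ abar))
    (hη : ∀ (w : DForm m M m) (abar : DForm m M k) (x : M), w x = 0 → η w abar x = 0) :
    IsFormalDual h o F ψ := by
  refine fun abar ha => ⟨hψ abar ha, fun w hw hsupp => ?_⟩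
  have hw0 : ∀ x ∈ (𝓡∂ (m + 1)).boundary M, w x = 0 := fun x hx => by
    rw [← ModelWithCorners.compl_interior] at hx
    exact by_contra fun hne => hx (hsupp (subset_closure hne))
  rw [(hsurf w abar hw ha).2, integralBdry_eq_zero o fun x hx => hη w abar x (hw0 x hx), add_zero]

variable [IsContMDiffRiemannianBundle (𝓡∂ (m + 1)) ∞ (EuclideanSpace ℝ (Fin (m + 1)))
  (fun x : M => TangentSpace (𝓡∂ (m + 1)) x)]

theorem chartIntegral_fsmul_vol_pos (o : ManifoldOrientation m M) {g : DForm m M 0}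
    (hg : IsSmooth g) (hg_nonneg : ∀ x, 0 ≤ fval g x) {K : Set M} (hK : IsCompact K)
    (hKi : K ⊆ (φ i).source) (h0 : ∀ x ∉ K, fval g x = 0) {x₀ : M}
    (hx₀ : x₀ ∈ (𝓡∂ (m + 1)).interior M) (hpos : 0 < fval g x₀) :
    0 < chartIntegral o (fsmul g (vol o)) i := by
  have hsource : x₀ ∈ (φ i).source := hKi (by_contra fun h => hpos.ne' (h0 x₀ h))
  have htarget : φ i x₀ ∈ (φ i).target := (φ i).map_source hsource
  have hnhds : (φ i).target ∈ 𝓝 (φ i x₀) := by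
    rw [← mem_interior_iff_mem_nhds, mem_interior_target_iff htarget,
      ← symm_mem_interior_iff htarget, (φ i).left_inv hsource]
    exact hx₀
  have hcont : ContinuousOn (fun y => fInChart (fval g) i y * |topCoef (vol o) i y|)
      (φ i).target :=
    (isSmooth_zero_iff.1 hg i).continuousOn.mul (contDiffOn_topCoef_vol o i).continuousOn.abs
  have hintegrand (y : 𝔼) : 0 ≤ fInChart (fval g) i y * |topCoef (vol o) i y| :=
    mul_nonneg (hg_nonneg _) (abs_nonneg _)
  have hint := integrableOn_target (isCompact_image_extChartAt hK hKi)
    (image_extChartAt_subset_target hKi) hcont fun y hy => by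
      rw [fInChart, h0 _ (symm_notMem_of_notMem_image hy), zero_mul]
  have hne : fInChart (fval g) i (φ i x₀) * |topCoef (vol o) i (φ i x₀)| ≠ 0 := by
    refine mul_ne_zero ?_ (abs_ne_zero.2 (topCoef_vol_ne_zero o htarget))
    rw [fInChart, (φ i).left_inv hsource]
    exact hpos.ne'
  simp_rw [chartIntegral, chartSign_mul_topCoef_fsmul_vol]
  rw [setIntegral_pos_iff_support_of_nonneg_ae
    (Eventually.of_forall hintegrand) hint]
  exact Measure.measure_pos_of_mem_nhds volume
    (inter_mem ((hcont.continuousAt hnhds).eventually_ne hne) hnhds)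

variable [CompactSpace M] [T2Space M]

theorem integralM_fsmul_vol_pos (o : ManifoldOrientation m M) {g : DForm m M 0}
    (hg : IsSmooth g) (hg_nonneg : ∀ x, 0 ≤ fval g x) {x₀ : M}
    (hx₀ : x₀ ∈ (𝓡∂ (m + 1)).interior M) (hpos : 0 < fval g x₀) :
    0 < integralM o (fsmul g (vol o)) := by
  have hassoc (i : M) : fsmul (ofFun (chartPOU m M i)) (fsmul g (vol o)) =
      fsmul (fsmul (ofFun (chartPOU m M i)) g) (vol o) := funext fun x => smul_smul _ _ _
  have hnonneg (i x : M) : 0 ≤ fval (fsmul (ofFun (chartPOU m M i)) g) x :=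
    mul_nonneg ((chartPOU m M).nonneg i x) (hg_nonneg x)
  obtain ⟨i, hi, hρ⟩ : ∃ i ∈ chartIdx m M, 0 < chartPOU m M i x₀ :=
    Finset.exists_lt_of_sum_lt (by simp [sum_chartPOU])
  simp_rw [integralM_eq_sum, hassoc]
  refine Finset.sum_pos' (fun i _ => chartIntegral_fsmul_vol_nonneg o (hnonneg i)) ⟨i, hi, ?_⟩
  refine chartIntegral_fsmul_vol_pos o ((isSmooth_chartPOU i).fsmul hg) (hnonneg i)
    (isClosed_tsupport _).isCompact (tsupport_chartPOU_subset i) (fun x hx => ?_) hx₀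
    (mul_pos hρ hpos)
  rw [fval, fsmul_chartPOU_eq_zero g hx]
  rfl

theorem oneForm_eq_zero_of_integralM_eq_zero (o : ManifoldOrientation m M) {γ : DForm m M 1}
    (hγ : IsSmooth γ)
    (h : ∀ v : VField m M, IsSmoothV v → closure {x | v x ≠ 0} ⊆ (𝓡∂ (m + 1)).interior M →
      integralM o (fsmul (contract v γ) (vol o)) = 0) : γ = 0 := by
  refine eq_zero_of_forall_mem_interior hγ fun c hc => ?_
  by_contra hne
  obtain ⟨t, ht⟩ : ∃ t, γ c t ≠ 0 := by
    by_contra! hcon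
    exact hne (ContinuousAlternatingMap.ext hcon)
  obtain ⟨χ, -, hχ⟩ := (SmoothBumpFunction.nhds_basis_tsupport (I := 𝓡∂ (m + 1)) c).mem_iff.1
    (((𝓡∂ (m + 1)).isOpen_interior (n := ∞) (by simp)).mem_nhds hc)
  let e : VField m M := coordField c (dChart c c (t 0))
  have hec : fval (contract e γ) c = γ c t := by
    rw [fval_contract_coordField γ _ (mem_extChartAt_source c),
      eq_inChart_comp γ (mem_extChartAt_source c)]
    exact congrArg (inChart γ c _) (funext fun l => by rw [Subsingleton.elim l 0]; rfl)
  have hv : IsSmoothV (testField χ γ e) :=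
    isSmoothV_testField (isSmooth_ofFun χ.contMDiff) χ.tsupport_subset_extChartAt_source hγ _
  have hsupp : closure {x | testField χ γ e x ≠ 0} ⊆ (𝓡∂ (m + 1)).interior M :=
    Subset.trans (closure_mono fun x hx hχx => hx (testField_eq_zero γ e hχx)) hχ
  refine (integralM_fsmul_vol_pos o (hγ.contract hv) (fun x => ?_) hc ?_).ne' (h _ hv hsupp)
  · rw [fval_contract_testField]
    exact mul_nonneg χ.nonneg (sq_nonneg _)
  · rw [fval_contract_testField, χ.eq_one, one_mul, hec]
    positivity

theorem eq_of_pairing_eq (o : ManifoldOrientation m M) {α β : DForm m M 1} (hα : IsSmooth α)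
    (hβ : IsSmooth β)
    (h : ∀ w : DForm m M m, IsSmooth w → closure {x | w x ≠ 0} ⊆ (𝓡∂ (m + 1)).interior M →
      pairing (Nat.add_comm 1 m) o α w = pairing (Nat.add_comm 1 m) o β w) : α = β := by
  refine sub_eq_zero.1 (oneForm_eq_zero_of_integralM_eq_zero o (hα.sub hβ) fun v hv hsupp => ?_)
  have hwedge (ξ : DForm m M 1) : wedge (Nat.add_comm 1 m) ξ (contract v (vol o)) =
      fsmul (contract v ξ) (vol o) := by
    rw [wedge_one _ o, hat_contract]
  have hsmooth {ξ : DForm m M 1} (hξ : IsSmooth ξ) : IsSmooth (fsmul (contract v ξ) (vol o)) :=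
    (hξ.contract hv).fsmul (isSmooth_vol o)
  have hcontract {x : M} (hx : v x = 0) : contract v (vol o) x = 0 := by
    have h0 := interiorAt_smul (0 : ℝ) (v x) (vol o x)
    rwa [zero_smul, zero_smul, ← hx] at h0
  have heq := h (contract v (vol o)) ((isSmooth_vol o).contract hv)
    (Subset.trans (closure_mono fun x hx hvx => hx (hcontract hvx)) hsupp)
  have hadd : fsmul (contract v α) (vol o) =
      fsmul (contract v (α - β)) (vol o) + fsmul (contract v β) (vol o) := by
    rw [← hwedge, ← hwedge, ← hwedge, ← wedge_add_left, sub_add_cancel]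
  rw [pairing, pairing, hwedge, hwedge, hadd,
    integralM_add o (hsmooth (hα.sub hβ)) (hsmooth hβ)] at heq
  exact add_eq_right.1 heq

variable {k l : ℕ} {h : k + l = m + 1} {o : ManifoldOrientation m M}
  {F : DForm m M m → DForm m M l} {ψ : DForm m M k → DForm m M 1}

theorem IsFormalDual.isFormalDual_iff (hψ : IsFormalDual h o F ψ)
    (ψ' : DForm m M k → DForm m M 1) :
    IsFormalDual h o F ψ' ↔ ∀ abar : DForm m M k, IsSmooth abar → ψ' abar = ψ abar := by
  refine ⟨fun hψ' abar ha => ?_, fun hψ' abar ha => ?_⟩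
  · exact eq_of_pairing_eq o (hψ' abar ha).1 (hψ abar ha).1 fun w hw hsupp =>
      ((hψ' abar ha).2 w hw hsupp).trans ((hψ abar ha).2 w hw hsupp).symm
  · rw [hψ' abar ha]
    exact hψ abar ha

end Uniqueness

section Duality

variable [RiemannianBundle (fun x : M => TangentSpace (𝓡∂ (m + 1)) x)]

theorem contract_hat_top (h : 0 + (m + 1) = m + 1) (o : ManifoldOrientation m M)
    (a : DForm m M (m + 1)) (w : DForm m M m) :
    contract (hat o w) a = fsmul (star h o a) w := by
  conv_lhs => rw [← fsmul_star_vol h o a, contract_fsmul, contract_hat]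

theorem wedge_fsmul_star_extD (h₁ : 1 + m = m + 1) (h₀ : 0 + (m + 1) = m + 1)
    (o : ManifoldOrientation m M) (a : DForm m M (m + 1)) (f : DForm m M 0) (w : DForm m M m) :
    wedge h₁ (fsmul (star h₀ o a) (extD f)) w = fsmul (lieD (hat o w) f) a := by
  rw [wedge_one h₁ o, contract_fsmul, contract_extD_zero, fsmul_fsmul_comm, fsmul_star_vol]

variable [IsManifold (𝓡∂ (m + 1)) ∞ M] [CompactSpace M] [T2Space M]

theorem pairing_lieD_zero (o : ManifoldOrientation m M) (a : DForm m M 0) (w : DForm m M m)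
    (b : DForm m M (m + 1)) :
    pairing (Nat.add_comm 1 m) o (fsmul (star (Nat.zero_add (m + 1)) o b) (extD a)) w =
      pairing (Nat.add_zero (m + 1)) o b (interconnection o a w) := by
  rw [pairing, pairing, wedge_fsmul_star_extD, wedge_zero_right, interconnection]

theorem hasSurfaceTerm_zero (o : ManifoldOrientation m M) (a : DForm m M 0) :
    HasSurfaceTerm (Nat.add_zero (m + 1)) o (interconnection o a)
      (fun b => fsmul (star (Nat.zero_add (m + 1)) o b) (extD a)) (fun _ _ => 0) := by
  refine fun w b _ _ => ⟨fun _ => contDiffOn_const (c := 0), ?_⟩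
  exact (pairing_lieD_zero o a w b).trans
    (left_eq_add.2 (integralBdry_eq_zero o fun _ _ => rfl))

variable [IsContMDiffRiemannianBundle (𝓡∂ (m + 1)) ∞ (EuclideanSpace ℝ (Fin (m + 1)))
  (fun x : M => TangentSpace (𝓡∂ (m + 1)) x)]

theorem pairing_lieD_top (o : ManifoldOrientation m M) {a : DForm m M (m + 1)} (ha : IsSmooth a)
    {w : DForm m M m} (hw : IsSmooth w) {b : DForm m M 0} (hb : IsSmooth b) :
    pairing (Nat.add_comm 1 m) o (-fsmul (star (Nat.zero_add (m + 1)) o a) (extD b)) w =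
      pairing (Nat.zero_add (m + 1)) o b (interconnection o a w) +
        integralBdry o (-wedge (Nat.add_zero m)
          (fsmul (star (Nat.zero_add (m + 1)) o a) w) b) := by
  have hv : IsSmoothV (hat o w) := isSmoothV_hat o hw
  have hparts : integralM o (fsmul (lieD (hat o w) b) a) +
      integralM o (fsmul b (lieD (hat o w) a)) =
        integralBdry o (fsmul b (fsmul (star (Nat.zero_add (m + 1)) o a) w)) := by
    rw [← integralM_add o ((hb.lieD_zero hv).fsmul ha) (hb.fsmul (ha.lieD_top hv)),
      ← lieD_fsmul_top hb hv ha, integralM_lieD o hv (hb.fsmul ha), contract_fsmul,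
      contract_hat_top]
  rw [pairing, pairing, wedge_neg_left, wedge_fsmul_star_extD, wedge_zero_left, wedge_zero_right,
    integralM_neg, integralBdry_neg, interconnection, ← hparts]
  ring

theorem hasSurfaceTerm_top (o : ManifoldOrientation m M) {a : DForm m M (m + 1)}
    (ha : IsSmooth a) :
    HasSurfaceTerm (Nat.zero_add (m + 1)) o (interconnection o a)
      (fun b => -fsmul (star (Nat.zero_add (m + 1)) o a) (extD b))
      (fun w b => -wedge (Nat.add_zero m) (fsmul (star (Nat.zero_add (m + 1)) o a) w) b) := by
  refine fun w b hw hb => ⟨?_, pairing_lieD_top o ha hw hb⟩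
  beta_reduce
  rw [wedge_zero_right]
  exact (hb.fsmul ((isSmooth_star _ o ha).fsmul hw)).neg

end Duality

end FluidForms

end

open FluidForms in
theorem proposition3 {m : ℕ} {M : Type*} [TopologicalSpace M]
    [ChartedSpace (EuclideanHalfSpace (m + 1)) M] [IsManifold (𝓡∂ (m + 1)) ∞ M]
    [CompactSpace M] [T2Space M]
    [RiemannianBundle (fun x : M => TangentSpace (𝓡∂ (m + 1)) x)]
    [IsContMDiffRiemannianBundle (𝓡∂ (m + 1)) ∞ (EuclideanSpace ℝ (Fin (m + 1)))
      (fun x : M => TangentSpace (𝓡∂ (m + 1)) x)]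
    (o : ManifoldOrientation m M) :
    -- `V = Ω^0(M)`, `V^* = Ω^n(M)`, `n = m + 1`
    (∀ a : DForm m M (m + 1), IsSmooth a →
      (∀ w : DForm m M m, IsSmooth w → IsSmooth (interconnection o a w)) ∧
      (∀ ψ : DForm m M 0 → DForm m M 1,
        IsFormalDual (Nat.zero_add (m + 1)) o (interconnection o a) ψ ↔
          ∀ abar : DForm m M 0, IsSmooth abar →
            ψ abar = -fsmul (star (Nat.zero_add (m + 1)) o a) (extD abar)) ∧
      HasSurfaceTerm (Nat.zero_add (m + 1)) o (interconnection o a)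
        (fun abar => -fsmul (star (Nat.zero_add (m + 1)) o a) (extD abar))
        (fun w abar => -wedge (Nat.add_zero m)
          (fsmul (star (Nat.zero_add (m + 1)) o a) w) abar)) ∧
    -- `V = Ω^n(M)`, `V^* = Ω^0(M)`
    (∀ a : DForm m M 0, IsSmooth a →
      (∀ w : DForm m M m, IsSmooth w → IsSmooth (interconnection o a w)) ∧
      (∀ ψ : DForm m M (m + 1) → DForm m M 1,
        IsFormalDual (Nat.add_zero (m + 1)) o (interconnection o a) ψ ↔
          ∀ abar : DForm m M (m + 1), IsSmooth abar →
            ψ abar = fsmul (star (Nat.zero_add (m + 1)) o abar) (extD a)) ∧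
      HasSurfaceTerm (Nat.add_zero (m + 1)) o (interconnection o a)
        (fun abar => fsmul (star (Nat.zero_add (m + 1)) o abar) (extD a))
        (fun _ _ => 0)) := by
  refine ⟨fun a ha => ?_, fun a ha => ?_⟩
  · have hsurf := hasSurfaceTerm_top o ha
    have hdual := hsurf.isFormalDual
      (fun b hb => ((isSmooth_star _ o ha).fsmul hb.extD_zero).neg) fun w b x hx => by
        rw [wedge_zero_right, Pi.neg_apply, fsmul, fsmul, hx, smul_zero, smul_zero, neg_zero]
    exact ⟨fun w hw => ha.lieD_top (isSmoothV_hat o hw), hdual.isFormalDual_iff, hsurf⟩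
  · have hsurf := hasSurfaceTerm_zero o a
    have hdual := hsurf.isFormalDual
      (fun b hb => (isSmooth_star _ o hb).fsmul ha.extD_zero) fun _ _ _ _ => rfl
    exact ⟨fun w hw => ha.lieD_zero (isSmoothV_hat o hw), hdual.isFormalDual_iff, hsurf⟩
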